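/- **Setting.** Let $\mathcal S$ be a compact metric space with a finite Borel reference measure $ds$ (for instance a compact subset of $\mathbb R^n$ with Lebesgue measure), and let $\mathcal A\subset\mathbb R^d$ be compact. Consider a Markov decision process with state space $\mathcal S$, action set $\mathcal A$, transition density $p(s'|s,a)$ and initial density $d_0(s)$ with respect to $ds$, reward $r(s,a)$ and discount factor $\gamma\in[0,1)$. Let $\Theta\subseteq\mathbb R^m$ be open and $\alpha\in\mathbb R$. For $\theta\in\Theta$ consider the mixture policy with action density $$\pi^m_\theta(a|s)=\sum_{k=1}^N \pi^w_\theta(k|s)\,\pi^c_\theta(a|s,k),\qquad a\in\mathcal A,$$ where the weights satisfy $\pi^w_\theta(k|s)>0$ and $\sum_k\pi^w_\theta(k|s)=1$. The components $\pi^c_\theta(\cdot|s,k)\ge 0$ are reparameterized: there are a set $E\subset\mathbb R^d$, a probability density $p(\varepsilon)$ on $E$ and, for all $\theta\in\Theta$, $s$, $k$, a bijection $f_\theta(\cdot;s,k):E\to\mathcal A$ with inverse $f_\theta^{-1}(\cdot;s,k)$, such that $a=f_\theta(\varepsilon;s,k)$ with $\varepsilon\sim p$ has density $\pi^c_\theta(\cdot|s,k)$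 on $\mathcal A$. Assume that $p(s'|s,a)$, $d_0(s)$, $r(s,a)$, $f_\theta(\varepsilon;s,k)$, $f_\theta^{-1}(a;s,k)$, $\pi^w_\theta(k|s)$, $\pi^c_\theta(a|s,k)$ and $p(\varepsilon)$ are jointly continuous in the variables $s,s',a,\theta,\varepsilon$ on which they depend, and that their first partial derivatives in $a$, $\theta$ and $\varepsilon$ exist and are jointly continuous as well. (As functions of $a\in\mathcal A$ or $\varepsilon\in E$ they are understood to be restrictions of functions on $\mathbb R^d$ with these properties; the derivatives in $\theta$ are taken at points of $\Theta$.) **Notation.** For a policy density $\pi$ let $\mathcal H(\pi(\cdot|s))=-\int_{\mathcal A}\pi(a|s)\log\pi(a|s)\,da$ (with $0\log 0=0$), let $\mathbb E_\pi$ be the expectation over trajectories with $S_0\sim d_0$, $A_t\sim\pi(\cdot|S_t)$, $S_{t+1}\sim p(\cdot|S_t,A_t)$, and put $$J(\pi)=\mathbb E_\pi\Big[\sum_{t\ge0}\gamma^t\big(r(S_t,A_t)+\alpha\mathcal H(\pi(\cdot|S_t))\big)\Big],$$ $$Q_\pi(s,a)=\mathbb E_\pi\Big[\sum_{t\ge0}\gamma^t\big(r(S_t,A_t)+\alpha\gamma\mathcal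 H(\pi(\cdot|S_{t+1}))\big)\,\Big|\,S_0=s,A_0=a\Big].$$ Let $d_\pi(B)=\sum_{t\ge0}\gamma^t\,\mathbb P_\pi(S_t\in B)$ be the unnormalized discounted occupancy measure. $\mathbb E_{s\sim d_\pi,\,k\sim\pi^w_\theta(\cdot|s),\,\varepsilon\sim p}$ denotes integration against $d_\pi(ds)\,\pi^w_\theta(k|s)\,p(\varepsilon)\,d\varepsilon$. Further, $\nabla_\theta f_\theta$ is the $m\times d$ transposed Jacobian of $f_\theta$ in $\theta$, and $\nabla_a$ is the gradient within $\mathcal A$. **Theorem (Entropy-Regularized Half-Reparameterization Policy Gradient Theorem).** For every $\theta\in\Theta$, the function $\theta\mapsto J(\pi^m_\theta)$ is differentiable at $\theta$, and, with $\pi=\pi^m_\theta$, $$\begin{aligned}\nabla_\theta J(\pi^m_\theta)=\mathbb E_{s\sim d_{\pi},\,k\sim\pi^w_\theta(\cdot|s),\,\varepsilon\sim p}\Big[&\nabla_\theta\log\pi^w_\theta(k|s)\,\big(Q_{\pi}(s,f_\theta(\varepsilon;s,k))-\alpha\log\pi^m_\theta(f_\theta(\varepsilon;s,k)|s)\big)\\&+\nabla_\theta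 f_\theta(\varepsilon;s,k)\,\nabla_a\big(Q_{\pi}(s,a)-\alpha\log\pi^m_\theta(a|s)\big)\big|_{a=f_\theta(\varepsilon;s,k)}\Big].\end{aligned}$$ Here, for almost every $(s,k,\varepsilon)$, the point $a=f_\theta(\varepsilon;s,k)$ lies in $\mathcal A$, $\pi^m_\theta(a|s)>0$ and $Q_\pi(s,\cdot)-\alpha\log\pi^m_\theta(\cdot|s)$ is differentiable at $a$ within $\mathcal A$, and the random vector in brackets is integrable. -/

import Mathlib

open MeasureTheory ProbabilityTheory

/-- The Euclidean space `ℝⁿ`. -/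
abbrev Vec (n : ℕ) : Type := EuclideanSpace ℝ (Fin n)

/-- The function `v ↦ g x v` is differentiable at `v` for every `(x, v) ∈ D`, and its derivative is
continuous on `D`, jointly in `(x, v)`. -/
def HasContPartial {X V F : Type*} [TopologicalSpace X] [NormedAddCommGroup V] [NormedSpace ℝ V]
    [NormedAddCommGroup F] [NormedSpace ℝ F] (D : Set (X × V)) (g : X → V → F) : Prop :=
  (∀ z ∈ D, DifferentiableAt ℝ (g z.1) z.2) ∧
    ContinuousOn (fun z : X × V => fderiv ℝ (g z.1) z.2) D

/-- The function `g θ s v` (with `θ ∈ Θ`) and its derivatives in `θ` and in `v` are jointly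
continuous. -/
structure ContC1 {S F : Type*} [TopologicalSpace S] [NormedAddCommGroup F] [NormedSpace ℝ F]
    {m d : ℕ} (Θ : Set (Vec m)) (g : Vec m → S → Vec d → F) : Prop where
  continuousOn : ContinuousOn (fun x : Vec m × S × Vec d => g x.1 x.2.1 x.2.2) {x | x.1 ∈ Θ}
  partial_param : HasContPartial {z : (S × Vec d) × Vec m | z.2 ∈ Θ} (fun y θ => g θ y.1 y.2)
  partial_var : HasContPartial {z : (Vec m × S) × Vec d | z.1.1 ∈ Θ} (fun y v => g y.1 y.2 v)

/-- A discounted Markov decision process with a compact action set `A ⊆ ℝᵈ`. The transition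
probabilities and the initial distribution have densities with respect to a reference measure `ν`
on the state space `S`. -/
structure MDP (S : Type*) [MeasurableSpace S] (ν : Measure S) (d : ℕ) where
  /-- the action set -/
  A : Set (Vec d)
  /-- the transition density; `trans s a s'` is `p(s' | s, a)` -/
  trans : S → Vec d → S → ℝ
  /-- the initial density `d₀` -/
  init : S → ℝ
  /-- the reward function `r` -/
  reward : S → Vec d → ℝ
  /-- the discount factor `γ` -/
  discount : ℝ
  isCompact_A : IsCompact A
  trans_nonneg : ∀ s, ∀ a ∈ A, ∀ s', 0 ≤ trans s a s'
  integral_trans : ∀ s, ∀ a ∈ A, ∫ s', trans s a s' ∂ν = 1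
  init_nonneg : ∀ s, 0 ≤ init s
  integral_init : ∫ s, init s ∂ν = 1
  discount_nonneg : 0 ≤ discount
  discount_lt_one : discount < 1

namespace MDP

variable {S : Type*} [MeasurableSpace S] {ν : Measure S} {d : ℕ}

/-- Lebesgue measure on the action set. -/
noncomputable def actionVolume (M : MDP S ν d) : Measure M.A :=
  Measure.comap Subtype.val (volume : Measure (Vec d))

instance isFiniteMeasure_actionVolume (M : MDP S ν d) : IsFiniteMeasure M.actionVolume := by
  refine ⟨?_⟩
  rw [actionVolume, (MeasurableEmbedding.subtype_coe M.isCompact_A.measurableSet).comap_apply,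
    Set.image_univ, Subtype.range_coe]
  exact M.isCompact_A.measure_lt_top

/-- The initial density, the transition density and the reward, and the derivatives of the latter
two with respect to the action, are jointly continuous. -/
structure Regular [TopologicalSpace S] (M : MDP S ν d) : Prop where
  continuous_init : Continuous M.init
  continuous_reward : Continuous fun x : S × Vec d => M.reward x.1 x.2
  partial_reward : HasContPartial Set.univ M.reward
  continuous_trans : Continuous fun x : S × Vec d × S => M.trans x.1 x.2.1 x.2.2
  partial_trans : HasContPartial Set.univ fun (x : S × S) a => M.trans x.1 a x.2

/-- The transition kernel `p(s' | s, a) ν(ds')`. -/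
noncomputable def transKernel (M : MDP S ν d) [SFinite ν] : Kernel (S × M.A) S :=
  (Kernel.const (S × M.A) ν).withDensity fun x s' => ENNReal.ofReal (M.trans x.1 x.2 s')

/-- The policy with action density `π`, as the kernel `π(a | s) da` on the action set. -/
noncomputable def policyKernel (M : MDP S ν d) (π : S → Vec d → ℝ) : Kernel S M.A :=
  (Kernel.const S M.actionVolume).withDensity fun s a => ENNReal.ofReal (π s a)

/-- One step `(S_t, A_t) ↦ (S_{t+1}, A_{t+1})` of the process controlled by `π`. -/
noncomputable def stepKernel (M : MDP S ν d) [SFinite ν] (π : S → Vec d → ℝ) :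
    Kernel (S × M.A) (S × M.A) :=
  M.transKernel ⊗ₖ Kernel.prodMkLeft (S × M.A) (M.policyKernel π)

open Classical in
/-- The law of the trajectory `(S_t, A_t)_{t ≥ 0}` under the policy `π` when `(S_0, A_0)` has
distribution `μ₀`. -/
noncomputable def trajLaw (M : MDP S ν d) [SFinite ν] (π : S → Vec d → ℝ)
    (μ₀ : Measure (S × M.A)) : Measure (ℕ → S × M.A) :=
  if h : IsMarkovKernel (M.stepKernel π) then
    haveI := h
    Kernel.trajMeasure (X := fun _ => S × M.A) μ₀ fun n =>
      (M.stepKernel π).comap (fun x => x ⟨n, Finset.mem_Iic.2 le_rfl⟩) (measurable_pi_apply _)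
  else 0

/-- The law of the trajectory under `π` with `S_0 ∼ d₀` and `A_0 ∼ π(· | S_0)`. -/
noncomputable def law (M : MDP S ν d) [SFinite ν] (π : S → Vec d → ℝ) :
    Measure (ℕ → S × M.A) :=
  M.trajLaw π ((ν.withDensity fun s => ENNReal.ofReal (M.init s)) ⊗ₘ M.policyKernel π)

/-- The differential entropy of `π(· | s)`. -/
noncomputable def entropy (M : MDP S ν d) (π : S → Vec d → ℝ) (s : S) : ℝ :=
  -∫ a in M.A, π s a * Real.log (π s a)

/-- The entropy-regularized objective
`J(π) = E_π[∑ₜ γᵗ (r(S_t, A_t) + α H(π(· | S_t)))]`. -/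
noncomputable def objective (M : MDP S ν d) [SFinite ν] (α : ℝ) (π : S → Vec d → ℝ) : ℝ :=
  ∫ ω, ∑' t : ℕ, M.discount ^ t *
    (M.reward (ω t).1 (ω t).2 + α * M.entropy π (ω t).1) ∂(M.law π)

open Classical in
/-- The soft action-value function
`Q_π(s, a) = E_π[∑ₜ γᵗ (r(S_t, A_t) + α γ H(π(· | S_{t+1}))) | S_0 = s, A_0 = a]` for `a ∈ A`
(and `0` for `a ∉ A`). -/
noncomputable def softQ (M : MDP S ν d) [SFinite ν] (α : ℝ) (π : S → Vec d → ℝ)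
    (s : S) (a : Vec d) : ℝ :=
  if ha : a ∈ M.A then
    ∫ ω, ∑' t : ℕ, M.discount ^ t *
      (M.reward (ω t).1 (ω t).2 + α * M.discount * M.entropy π (ω (t + 1)).1)
      ∂(M.trajLaw π (Measure.dirac (s, ⟨a, ha⟩)))
  else 0

/-- The (unnormalized) discounted occupancy measure
`d_π(B) = ∑ₜ γᵗ P_π(S_t ∈ B)`. -/
noncomputable def occupancy (M : MDP S ν d) [SFinite ν] (π : S → Vec d → ℝ) : Measure S :=
  Measure.sum fun t : ℕ =>
    ENNReal.ofReal (M.discount ^ t) • (M.law π).map fun ω => (ω t).1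

end MDP

/-- The data of a parametrized mixture policy with `N` components on `ℝᵈ`, together with a
reparameterization of the components. -/
structure ReparamMixture (S : Type*) (m N d : ℕ) where
  /-- the parameter set -/
  Θ : Set (Vec m)
  /-- the set in which the noise takes its values -/
  E : Set (Vec d)
  /-- the noise density `p(ε)` -/
  noise : Vec d → ℝ
  /-- the weighting policy `π^w_θ(k | s)` -/
  weight : Vec m → S → Fin N → ℝ
  /-- the component policies `π^c_θ(a | s, k)` -/
  comp : Vec m → S → Fin N → Vec d → ℝ
  /-- the reparameterization `f_θ(ε; s, k)` -/
  f : Vec m → S → Fin N → Vec d → Vec d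
  /-- the inverse `f_θ⁻¹(a; s, k)` -/
  finv : Vec m → S → Fin N → Vec d → Vec d

namespace ReparamMixture

variable {S : Type*} {m N d : ℕ}

/-- The density of the mixture policy, `π^m_θ(a | s) = ∑ₖ π^w_θ(k | s) π^c_θ(a | s, k)`. -/
def mixture (P : ReparamMixture S m N d) (θ : Vec m) (s : S) (a : Vec d) : ℝ :=
  ∑ k, P.weight θ s k * P.comp θ s k a

/-- The distribution `p(ε) dε` of the noise on `E`. -/
noncomputable def noiseLaw (P : ReparamMixture S m N d) : Measure (Vec d) :=
  (volume.restrict P.E).withDensity fun ε => ENNReal.ofReal (P.noise ε)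

/-- The weighting policy as a kernel from states to component indices. -/
noncomputable def weightKernel [MeasurableSpace S] (P : ReparamMixture S m N d) (θ : Vec m) :
    Kernel S (Fin N) :=
  (Kernel.const S Measure.count).withDensity fun s k => ENNReal.ofReal (P.weight θ s k)

/-- The data `P` describe a mixture policy on the action set `A`: the parameters range over an open
set, the noise and the weights are probability distributions, all weights are positive, and for each
`θ`, `s`, `k` the map `f_θ(·; s, k)` is a bijection from `E` to `A`, with inverse `f_θ⁻¹(·; s, k)`,
such that `f_θ(ε; s, k)` with `ε ∼ p` has density `π^c_θ(· | s, k)` on `A`. -/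
structure IsPolicyOn (P : ReparamMixture S m N d) (A : Set (Vec d)) : Prop where
  isOpen_Θ : IsOpen P.Θ
  noise_nonneg : ∀ ε ∈ P.E, 0 ≤ P.noise ε
  integral_noise : ∫ ε in P.E, P.noise ε = 1
  weight_pos : ∀ θ ∈ P.Θ, ∀ s k, 0 < P.weight θ s k
  sum_weight : ∀ θ ∈ P.Θ, ∀ s, ∑ k, P.weight θ s k = 1
  comp_nonneg : ∀ θ ∈ P.Θ, ∀ s k, ∀ a ∈ A, 0 ≤ P.comp θ s k a
  mapsTo : ∀ θ ∈ P.Θ, ∀ s k, Set.MapsTo (P.f θ s k) P.E A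
  mapsTo_inv : ∀ θ ∈ P.Θ, ∀ s k, Set.MapsTo (P.finv θ s k) A P.E
  invOn : ∀ θ ∈ P.Θ, ∀ s k, Set.InvOn (P.finv θ s k) (P.f θ s k) P.E A
  map_noise : ∀ θ ∈ P.Θ, ∀ s k, P.noiseLaw.map (P.f θ s k) =
    (volume.restrict A).withDensity fun a => ENNReal.ofReal (P.comp θ s k a)

/-- The functions in `P` and their derivatives with respect to `θ`, `a` and `ε` are jointly
continuous. -/
structure Regular [TopologicalSpace S] (P : ReparamMixture S m N d) : Prop where
  contDiff_noise : ContDiff ℝ 1 P.noise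
  continuousOn_weight : ∀ k,
    ContinuousOn (fun x : Vec m × S => P.weight x.1 x.2 k) {x | x.1 ∈ P.Θ}
  partial_weight : ∀ k,
    HasContPartial {z : S × Vec m | z.2 ∈ P.Θ} fun s θ => P.weight θ s k
  comp : ∀ k, ContC1 P.Θ fun θ s a => P.comp θ s k a
  f : ∀ k, ContC1 P.Θ fun θ s ε => P.f θ s k ε
  finv : ∀ k, ContC1 P.Θ fun θ s a => P.finv θ s k a

/-- The joint "distribution" of `(s, k, ε)` with `s ∼ d_π` for `π = π^m_θ`, `k ∼ π^w_θ(· | s)` and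
`ε ∼ p` (its total mass is that of `d_π`). -/
noncomputable def sampling [MeasurableSpace S] {ν : Measure S} [SFinite ν]
    (P : ReparamMixture S m N d) (M : MDP S ν d) (θ : Vec m) : Measure (S × Fin N × Vec d) :=
  M.occupancy (P.mixture θ) ⊗ₘ (P.weightKernel θ ×ₖ Kernel.const S P.noiseLaw)

/-- The function `a ↦ Q_π(s, a) - α log π(a | s)` for `π = π^m_θ`. -/
noncomputable def regQ [MeasurableSpace S] {ν : Measure S} [SFinite ν]
    (P : ReparamMixture S m N d) (M : MDP S ν d) (α : ℝ) (θ : Vec m) (s : S) (a : Vec d) : ℝ :=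
  M.softQ α (P.mixture θ) s a - α * Real.log (P.mixture θ s a)

/-- The random vector
`∇_θ log π^w_θ(k | s) (Q_π(s, f_θ(ε; s, k)) - α log π^m_θ(f_θ(ε; s, k) | s))
  + ∇_θ f_θ(ε; s, k) ∇_a (Q_π(s, a) - α log π^m_θ(a | s))` at `a = f_θ(ε; s, k)`,
where `∇_θ f_θ` is the transposed Jacobian. -/
noncomputable def halfReparam [MeasurableSpace S] {ν : Measure S} [SFinite ν]
    (P : ReparamMixture S m N d) (M : MDP S ν d) (α : ℝ) (θ : Vec m)
    (x : S × Fin N × Vec d) : Vec m :=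
  let s := x.1
  let k := x.2.1
  let ε := x.2.2
  P.regQ M α θ s (P.f θ s k ε) • gradient (fun θ' => Real.log (P.weight θ' s k)) θ +
    ContinuousLinearMap.adjoint (fderiv ℝ (fun θ' => P.f θ' s k ε) θ)
      (gradientWithin (P.regQ M α θ s) M.A (P.f θ s k ε))

end ReparamMixture

/-! Neither `Q_π` nor `d_π` has to be differentiated in `θ`. Freeze the base policy `π = π_θ` and
let `L(π')(s)` be the expectation of `Q_π(s, ·)` under `π'` plus `α H(π'(· | s))`. The performance
difference formula `J(π') - J(π) = ∫ (L(π') - L(π)) d d_{π'}` (`objective_sub`) shows that the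
derivative of `J` at `θ` is the integral of the derivative of `L` against `d_π`. This requires only
that `θ' ↦ L(π_θ')` be differentiable with uniform bounds, that all `d_{π'}` be dominated by one
multiple of `ν`, and that integrals of bounded functions against `d_{π_θ'}` be continuous at `θ`
(`hasFDerivAt_integral_sub_of_dominated`).

For `L`, the entropy is absorbed into the integrand: `L(π_θ') = ∑ₖ w_k ∫ (Q_π - α log π_θ')(f_θ'(ε))
p(ε) dε`. The derivative has a weight term, a path term and `-α` times the expected score. The last
one vanishes because `∫ π_θ' = 1`.

The analytic difficulty is that `log π` and `1/π` are unbounded where the policy density is small.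
The change of variables formula `p(ε) = |det Df(ε)| π^c(f(ε))` gives `1/π(f(ε)) ≤ K²/p(ε)`, and
`1/p` is integrable against `p(ε) dε` because `E` is compact. Hence `1 + 1/p` dominates every
integrand (`mixture_pos`, `integrable_noiseBound`).

Two further points concern actions. `Q_π` is meaningful only on `A`, but the Bellman equation
extends it to a `C¹` function `bellmanQ` on `ℝᵈ`. And `A` is an arbitrary compact set, so a gradient
within `A` need not be unique; it is unique at almost every point of `A`
(`ae_eq_of_hasFDerivWithinAt`), which suffices because `f_θ(ε)` has a density on `A`. -/

set_option linter.unusedSectionVars false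

open Filter Topology

/-! ### Bounded measurable functions -/

/-- The function `h` is strongly measurable and bounded. -/
def BddMeas {X F : Type*} [MeasurableSpace X] [NormedAddCommGroup F] (h : X → F) : Prop :=
  StronglyMeasurable h ∧ ∃ C, ∀ x, ‖h x‖ ≤ C

namespace BddMeas

variable {X Y F : Type*} [MeasurableSpace X] [MeasurableSpace Y] [NormedAddCommGroup F]

lemma exists_bound {h : X → F} (hh : BddMeas h) : ∃ C, 0 ≤ C ∧ ∀ x, ‖h x‖ ≤ C := by
  obtain ⟨-, C, hC⟩ := hh
  exact ⟨max C 0, le_max_right _ _, fun x => (hC x).trans (le_max_left _ _)⟩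

lemma integrable {h : X → F} (hh : BddMeas h) (μ : Measure X) [IsFiniteMeasure μ] :
    Integrable h μ := by
  obtain ⟨C, hC⟩ := hh.2
  exact Integrable.of_bound hh.1.aestronglyMeasurable C (ae_of_all _ hC)

lemma comp {h : X → F} (hh : BddMeas h) {g : Y → X} (hg : Measurable g) :
    BddMeas fun y => h (g y) :=
  ⟨hh.1.comp_measurable hg, hh.2.imp fun _ hC y => hC (g y)⟩

lemma add {h g : X → F} (hh : BddMeas h) (hg : BddMeas g) : BddMeas fun x => h x + g x := by
  obtain ⟨C, hC⟩ := hh.2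
  obtain ⟨D, hD⟩ := hg.2
  exact ⟨hh.1.add hg.1, C + D, fun x => (norm_add_le _ _).trans (add_le_add (hC x) (hD x))⟩

lemma const_mul {h : X → ℝ} (hh : BddMeas h) (c : ℝ) : BddMeas fun x => c * h x := by
  obtain ⟨C, hC⟩ := hh.2
  refine ⟨hh.1.const_mul c, ‖c‖ * C, fun x => ?_⟩
  rw [norm_mul]
  exact mul_le_mul_of_nonneg_left (hC x) (norm_nonneg _)

variable [NormedSpace ℝ F]

lemma norm_integral_le {h : X → F} {C : ℝ} (hC : ∀ x, ‖h x‖ ≤ C) (μ : Measure X)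
    [IsProbabilityMeasure μ] : ‖∫ x, h x ∂μ‖ ≤ C := by
  simpa using norm_integral_le_of_norm_le_const (μ := μ) (ae_of_all _ hC)

lemma integral_kernel {h : Y → F} (hh : BddMeas h) (κ : Kernel X Y) [IsMarkovKernel κ] :
    BddMeas fun x => ∫ y, h y ∂κ x := by
  refine ⟨?_, hh.2.imp fun C hC x => norm_integral_le hC (κ x)⟩
  exact StronglyMeasurable.integral_kernel_prod_right (f := fun _ : X => h)
    (hh.1.comp_measurable measurable_snd)

lemma integral_kernel_prod {q : X × Y → F} (hq : BddMeas q) (κ : Kernel X Y) [IsMarkovKernel κ] :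
    BddMeas fun x => ∫ y, q (x, y) ∂κ x := by
  obtain ⟨hm, C, hC⟩ := hq
  exact ⟨hm.integral_kernel_prod_right' (κ := κ), C,
    fun x => norm_integral_le (fun y => hC (x, y)) _⟩

lemma integral_map {h : X → F} (hh : BddMeas h) {g : Y → X} (hg : Measurable g) (μ : Measure Y) :
    ∫ x, h x ∂μ.map g = ∫ y, h (g y) ∂μ :=
  MeasureTheory.integral_map hg.aemeasurable hh.1.aestronglyMeasurable

lemma integral_measure_comp {h : Y → F} (hh : BddMeas h) (κ : Kernel X Y) [IsMarkovKernel κ]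
    (μ : Measure X) [IsFiniteMeasure μ] :
    ∫ y, h y ∂(κ ∘ₘ μ) = ∫ x, ∫ y, h y ∂κ x ∂μ := by
  have : Integrable h (κ ∘ₘ μ) := hh.integrable _
  rw [Measure.comp_eq_comp_const_apply] at this ⊢
  rw [Kernel.integral_comp this, Kernel.const_apply]

end BddMeas

/-! ### Iterates of a Markov kernel acting on bounded functions -/

section Resolvent

variable {X : Type*} [MeasurableSpace X]

/-- The action of a kernel on real functions. -/
noncomputable def kernelAct (K : Kernel X X) (h : X → ℝ) (x : X) : ℝ := ∫ y, h y ∂K x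

/-- The discounted sum `∑ₜ γᵗ Kᵗ c`. -/
noncomputable def discountedResolvent (K : Kernel X X) (γ : ℝ) (c : X → ℝ) (x : X) : ℝ :=
  ∑' t : ℕ, γ ^ t * ((kernelAct K)^[t] c) x

variable {K : Kernel X X} [IsMarkovKernel K] {γ : ℝ} {c : X → ℝ}

lemma norm_kernelAct_iterate_le {C : ℝ} (hC : ∀ x, ‖c x‖ ≤ C) (t : ℕ) (x : X) :
    ‖((kernelAct K)^[t] c) x‖ ≤ C := by
  induction t generalizing x with
  | zero => exact hC x
  | succ t ih =>
    rw [Function.iterate_succ_apply']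
    exact BddMeas.norm_integral_le ih (K x)

lemma BddMeas.kernelAct_iterate (hc : BddMeas c) (t : ℕ) : BddMeas ((kernelAct K)^[t] c) := by
  induction t with
  | zero => exact hc
  | succ t ih =>
    rw [Function.iterate_succ_apply']
    exact ih.integral_kernel K

lemma summable_discounted {f : ℕ → ℝ} {C : ℝ} (hγ : 0 ≤ γ) (hγ1 : γ < 1)
    (hf : ∀ t, ‖f t‖ ≤ C) : Summable fun t => γ ^ t * f t := by
  refine Summable.of_norm_bounded ((summable_geometric_of_lt_one hγ hγ1).mul_right C) fun t => ?_
  rw [norm_mul, Real.norm_of_nonneg (pow_nonneg hγ t)]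
  exact mul_le_mul_of_nonneg_left (hf t) (pow_nonneg hγ t)

lemma norm_tsum_discounted_le {f : ℕ → ℝ} {C : ℝ} (hγ : 0 ≤ γ) (hγ1 : γ < 1)
    (hf : ∀ t, ‖f t‖ ≤ C) : ‖∑' t, γ ^ t * f t‖ ≤ (1 - γ)⁻¹ * C := by
  refine tsum_of_norm_bounded ((hasSum_geometric_of_lt_one hγ hγ1).mul_right C) fun t => ?_
  rw [norm_mul, Real.norm_of_nonneg (pow_nonneg hγ t)]
  exact mul_le_mul_of_nonneg_left (hf t) (pow_nonneg hγ t)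

lemma BddMeas.tsum_discounted {Y : Type*} [MeasurableSpace Y] {f : ℕ → Y → ℝ} {C : ℝ}
    (hγ : 0 ≤ γ) (hγ1 : γ < 1) (hfm : ∀ t, StronglyMeasurable (f t)) (hf : ∀ t y, ‖f t y‖ ≤ C) :
    BddMeas fun y => ∑' t, γ ^ t * f t y :=
  ⟨(Measurable.tsum fun t => ((hfm t).measurable.const_mul _)).stronglyMeasurable,
    (1 - γ)⁻¹ * C, fun y => norm_tsum_discounted_le hγ hγ1 fun t => hf t y⟩

/-- Discounted sums of uniformly bounded functions may be integrated term by term. -/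
lemma integral_tsum_discounted {Y : Type*} [MeasurableSpace Y] {f : ℕ → Y → ℝ} {C : ℝ}
    (hγ : 0 ≤ γ) (hγ1 : γ < 1) (hfm : ∀ t, StronglyMeasurable (f t)) (hf : ∀ t y, ‖f t y‖ ≤ C)
    (μ : Measure Y) [IsFiniteMeasure μ] :
    ∫ y, ∑' t, γ ^ t * f t y ∂μ = ∑' t, γ ^ t * ∫ y, f t y ∂μ := by
  have hb : ∀ t, BddMeas fun y => γ ^ t * f t y :=
    fun t => BddMeas.const_mul ⟨hfm t, C, hf t⟩ _
  rw [← integral_tsum_of_summable_integral_norm (fun t => (hb t).integrable μ)]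
  · simp_rw [integral_const_mul]
  · refine Summable.of_nonneg_of_le (fun t => integral_nonneg fun _ => norm_nonneg _)
      (fun t => ?_) ((summable_geometric_of_lt_one hγ hγ1).mul_right (C * μ.real Set.univ))
    calc ∫ y, ‖γ ^ t * f t y‖ ∂μ ≤ ∫ _, γ ^ t * C ∂μ := by
          refine integral_mono ((hb t).integrable μ).norm (integrable_const _) fun y => ?_
          rw [norm_mul, Real.norm_of_nonneg (pow_nonneg hγ t)]
          exact mul_le_mul_of_nonneg_left (hf t y) (pow_nonneg hγ t)
      _ = γ ^ t * (C * μ.real Set.univ) := by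
          rw [integral_const, smul_eq_mul]; ring

lemma BddMeas.discountedResolvent (hc : BddMeas c) (hγ : 0 ≤ γ) (hγ1 : γ < 1) :
    BddMeas (discountedResolvent K γ c) := by
  obtain ⟨C, hC⟩ := hc.2
  exact BddMeas.tsum_discounted hγ hγ1 (fun t => (hc.kernelAct_iterate t).1)
    fun t y => norm_kernelAct_iterate_le hC t y

/-- Splitting off the term `t = 0` leaves `γ K` applied to the same series. For the step kernel this
becomes the Bellman equation. -/
lemma discountedResolvent_eq (hc : BddMeas c) (hγ : 0 ≤ γ) (hγ1 : γ < 1) (x : X) :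
    discountedResolvent K γ c x = c x + γ * ∫ y, discountedResolvent K γ c y ∂K x := by
  obtain ⟨C, hC⟩ := hc.2
  unfold discountedResolvent
  rw [integral_tsum_discounted hγ hγ1 (fun t => (hc.kernelAct_iterate t).1)
      (fun t y => norm_kernelAct_iterate_le hC t y),
    (summable_discounted hγ hγ1 fun t => norm_kernelAct_iterate_le hC t x).tsum_eq_zero_add,
    ← tsum_mul_left]
  congr 1
  · simp
  · refine tsum_congr fun t => ?_
    rw [Function.iterate_succ_apply', pow_succ', mul_assoc]
    rfl

lemma integral_eq_integral_iterate {μ : ℕ → Measure X} [∀ t, IsProbabilityMeasure (μ t)]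
    (hμ : ∀ t, μ (t + 1) = K ∘ₘ μ t) (t : ℕ) (hc : BddMeas c) :
    ∫ x, c x ∂μ t = ∫ x, ((kernelAct K)^[t] c) x ∂μ 0 := by
  induction t generalizing c with
  | zero => rfl
  | succ t ih =>
    rw [hμ, hc.integral_measure_comp, Function.iterate_succ_apply]
    exact ih (hc.integral_kernel K)

end Resolvent

/-! ### Marginals of a homogeneous Markov chain -/

section Chain

variable {X : Type*} [MeasurableSpace X] (K : Kernel X X) [IsMarkovKernel K]

/-- The law of the homogeneous Markov chain with kernel `K` and initial distribution `μ₀`. -/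
noncomputable def chainLaw (μ₀ : Measure X) : Measure (ℕ → X) :=
  Kernel.trajMeasure (X := fun _ => X) μ₀ fun n =>
    K.comap (fun x => x ⟨n, Finset.mem_Iic.2 le_rfl⟩) (measurable_pi_apply _)

instance isProbabilityMeasure_chainLaw (μ₀ : Measure X) [IsProbabilityMeasure μ₀] :
    IsProbabilityMeasure (chainLaw K μ₀) := by
  unfold chainLaw; infer_instance

lemma chainLaw_map_zero (μ₀ : Measure X) [IsProbabilityMeasure μ₀] :
    (chainLaw K μ₀).map (fun ω => ω 0) = μ₀ := by
  have h : (fun ω : ℕ → X => ω 0) = (fun x : (Finset.Iic 0 → X) => x ⟨0, by simp⟩) ∘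
      Preorder.frestrictLe (π := fun _ => X) 0 := rfl
  rw [h, ← Measure.map_map (measurable_pi_apply _) (by fun_prop), chainLaw, Kernel.trajMeasure,
    Measure.map_comp _ _ (by fun_prop), Kernel.traj_map_frestrictLe, Kernel.partialTraj_self,
    Measure.id_comp, Measure.map_map (measurable_pi_apply _) (by fun_prop)]
  exact Measure.map_id

/-- The history up to time `n` together with the next state is a composition product. Projecting to
the next state leaves a kernel that sees the history only through its last coordinate. -/
lemma chainLaw_map_succ (μ₀ : Measure X) [IsProbabilityMeasure μ₀] (n : ℕ) :
    (chainLaw K μ₀).map (fun ω => ω (n + 1)) = K ∘ₘ (chainLaw K μ₀).map (fun ω => ω n) := by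
  have h := Kernel.map_frestrictLe_trajMeasure_compProd_eq_map_trajMeasure (X := fun _ => X)
    (μ₀ := μ₀) (κ := fun n => K.comap (fun x : (Finset.Iic n → X) =>
      x ⟨n, Finset.mem_Iic.2 le_rfl⟩) (measurable_pi_apply _)) (a := n)
  have h2 := congrArg (Measure.map Prod.snd) h
  rw [Measure.map_map measurable_snd (by fun_prop), ← Measure.snd, Measure.snd_compProd] at h2
  refine h2.symm.trans ?_
  have h3 : (fun ω : ℕ → X => ω n) = (fun x : (Finset.Iic n → X) =>
      x ⟨n, Finset.mem_Iic.2 le_rfl⟩) ∘ Preorder.frestrictLe (π := fun _ => X) n := rfl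
  rw [h3, ← Measure.map_map (measurable_pi_apply _) (by fun_prop)]
  ext s hs
  rw [Measure.bind_apply hs (Kernel.aemeasurable _), Measure.bind_apply hs (Kernel.aemeasurable _),
    lintegral_map (K.measurable_coe hs) (measurable_pi_apply _)]
  rfl

end Chain

/-! ### The controlled process -/

namespace MDP

variable {S : Type*} [MetricSpace S] [CompactSpace S] [MeasurableSpace S] [BorelSpace S]
  {ν : Measure S} [IsFiniteMeasure ν] {d : ℕ} {M : MDP S ν d}

/-- The function `π` is a policy density on the action set, with bounded entropy. -/
structure IsPolicy (M : MDP S ν d) (π : S → Vec d → ℝ) : Prop where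
  measurable : Measurable fun x : S × Vec d => π x.1 x.2
  nonneg : ∀ s, ∀ a ∈ M.A, 0 ≤ π s a
  integral_eq_one : ∀ s, ∫ a in M.A, π s a = 1
  entropy : BddMeas (M.entropy π)

lemma measurableSet_A (M : MDP S ν d) : MeasurableSet M.A := M.isCompact_A.measurableSet

lemma Regular.exists_trans_le (hM : M.Regular) :
    ∃ C, 0 ≤ C ∧ ∀ s, ∀ a ∈ M.A, ∀ s', M.trans s a s' ≤ C := by
  obtain ⟨C, hC⟩ := (isCompact_univ.prod (M.isCompact_A.prod isCompact_univ)).exists_bound_of_continuousOn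
    hM.continuous_trans.continuousOn
  exact ⟨max C 0, le_max_right _ _, fun s a ha s' => ((le_abs_self _).trans
    (hC (s, a, s') ⟨trivial, ha, trivial⟩)).trans (le_max_left _ _)⟩

lemma Regular.exists_init_le (hM : M.Regular) : ∃ C, 0 ≤ C ∧ ∀ s, M.init s ≤ C := by
  obtain ⟨C, hC⟩ := isCompact_univ.exists_bound_of_continuousOn
    hM.continuous_init.continuousOn
  exact ⟨max C 0, le_max_right _ _, fun s => ((le_abs_self _).trans
    (hC s trivial)).trans (le_max_left _ _)⟩

lemma Regular.bddMeas_reward (hM : M.Regular) :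
    BddMeas fun x : S × M.A => M.reward x.1 x.2 := by
  refine ⟨(hM.continuous_reward.comp (by fun_prop : Continuous fun x : S × M.A =>
    (x.1, (x.2 : Vec d)))).measurable.stronglyMeasurable, ?_⟩
  obtain ⟨C, hC⟩ := (isCompact_univ.prod M.isCompact_A).exists_bound_of_continuousOn
    hM.continuous_reward.continuousOn
  exact ⟨C, fun x => hC (x.1, x.2) ⟨trivial, x.2.2⟩⟩

lemma Regular.measurable_trans (hM : M.Regular) :
    Measurable (Function.uncurry fun (x : S × M.A) s' => ENNReal.ofReal (M.trans x.1 x.2 s')) :=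
  (hM.continuous_trans.comp (by fun_prop : Continuous fun x : (S × M.A) × S =>
    (x.1.1, (x.1.2 : Vec d), x.2))).measurable.ennreal_ofReal

lemma Regular.isMarkovKernel_transKernel (hM : M.Regular) : IsMarkovKernel M.transKernel := by
  refine ⟨fun x => ⟨?_⟩⟩
  rw [transKernel, Kernel.withDensity_apply _ hM.measurable_trans, Kernel.const_apply,
    withDensity_apply _ MeasurableSet.univ, Measure.restrict_univ,
    ← ofReal_integral_eq_lintegral_ofReal
      (integrable_of_integral_eq_one (M.integral_trans x.1 x.2 x.2.2))
      (ae_of_all _ (M.trans_nonneg x.1 x.2 x.2.2)), M.integral_trans x.1 x.2 x.2.2,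
    ENNReal.ofReal_one]

lemma Regular.integral_transKernel (hM : M.Regular) {F : Type*} [NormedAddCommGroup F]
    [NormedSpace ℝ F] (h : S → F) (x : S × M.A) :
    ∫ s', h s' ∂M.transKernel x = ∫ s', M.trans x.1 x.2 s' • h s' ∂ν := by
  rw [transKernel, Kernel.withDensity_apply _ hM.measurable_trans, Kernel.const_apply,
    integral_withDensity_eq_integral_toReal_smul
      (show Measurable fun s' => ENNReal.ofReal (M.trans x.1 x.2 s') from
        hM.measurable_trans.comp measurable_prodMk_left)
      (ae_of_all _ fun _ => ENNReal.ofReal_lt_top)]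
  exact integral_congr_ae (ae_of_all _ fun s' => by
    simp only [ENNReal.toReal_ofReal (M.trans_nonneg x.1 x.2 x.2.2 s')])

variable {π : S → Vec d → ℝ}

namespace IsPolicy

lemma measurable_density (hπ : M.IsPolicy π) :
    Measurable (Function.uncurry fun s (a : M.A) => ENNReal.ofReal (π s a)) :=
  (hπ.measurable.comp (by fun_prop : Measurable fun x : S × M.A =>
    (x.1, (x.2 : Vec d)))).ennreal_ofReal

lemma integral_policyKernel (hπ : M.IsPolicy π) {F : Type*} [NormedAddCommGroup F]
    [NormedSpace ℝ F] (q : Vec d → F) (s : S) :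
    ∫ a, q a ∂M.policyKernel π s = ∫ a in M.A, π s a • q a := by
  rw [policyKernel, Kernel.withDensity_apply _ hπ.measurable_density, Kernel.const_apply,
    integral_withDensity_eq_integral_toReal_smul
      (show Measurable fun a : M.A => ENNReal.ofReal (π s a) from
        hπ.measurable_density.comp measurable_prodMk_left)
      (ae_of_all _ fun _ => ENNReal.ofReal_lt_top),
    ← integral_subtype_comap M.measurableSet_A (fun a => π s a • q a)]
  exact integral_congr_ae (ae_of_all _ fun a => by
    simp only [ENNReal.toReal_ofReal (hπ.nonneg s a a.2)])

lemma isMarkovKernel_policyKernel (hπ : M.IsPolicy π) : IsMarkovKernel (M.policyKernel π) := by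
  refine ⟨fun s => ⟨?_⟩⟩
  have hi : Integrable (fun a : M.A => π s a) M.actionVolume := by
    refine integrable_of_integral_eq_one ?_
    rw [actionVolume, integral_subtype_comap M.measurableSet_A, hπ.integral_eq_one]
  rw [policyKernel, Kernel.withDensity_apply _ hπ.measurable_density, Kernel.const_apply,
    withDensity_apply _ MeasurableSet.univ, Measure.restrict_univ,
    ← ofReal_integral_eq_lintegral_ofReal hi (ae_of_all _ fun a => hπ.nonneg s a a.2),
    actionVolume, integral_subtype_comap M.measurableSet_A, hπ.integral_eq_one, ENNReal.ofReal_one]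

end IsPolicy

lemma sum_ofReal_discount (M : MDP S ν d) :
    ∑' t : ℕ, ENNReal.ofReal (M.discount ^ t) = ENNReal.ofReal (1 - M.discount)⁻¹ := by
  rw [← ENNReal.ofReal_tsum_of_nonneg (fun t => pow_nonneg M.discount_nonneg t)
    (summable_geometric_of_lt_one M.discount_nonneg M.discount_lt_one),
    tsum_geometric_of_lt_one M.discount_nonneg M.discount_lt_one]

section ControlledChain

variable [IsMarkovKernel M.transKernel] [IsMarkovKernel (M.policyKernel π)]

instance : IsMarkovKernel (M.stepKernel π) := by
  unfold stepKernel; infer_instance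

lemma trajLaw_eq_chainLaw (μ₀ : Measure (S × M.A)) :
    M.trajLaw π μ₀ = chainLaw (M.stepKernel π) μ₀ := by
  have h : IsMarkovKernel (M.stepKernel π) := inferInstance
  rw [trajLaw, dif_pos h]; rfl

/-- The new action is drawn from the new state alone, so after any step the joint law is a state law
composed with the policy. This reduces the process to its state marginals. -/
lemma stepKernel_comp (μ : Measure (S × M.A)) [SFinite μ] :
    M.stepKernel π ∘ₘ μ = (M.transKernel ∘ₘ μ) ⊗ₘ M.policyKernel π := by
  ext B hB
  rw [Measure.bind_apply hB (Kernel.aemeasurable _), Measure.compProd_apply hB,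
    Measure.lintegral_bind (Kernel.aemeasurable _)
      (Kernel.measurable_kernel_prodMk_left hB).aemeasurable]
  simp_rw [stepKernel, Kernel.compProd_apply hB, Kernel.prodMkLeft_apply]

lemma integral_stepKernel {h : S × M.A → ℝ} (hh : BddMeas h) (x : S × M.A) :
    ∫ y, h y ∂M.stepKernel π x = ∫ s, ∫ a, h (s, a) ∂M.policyKernel π s ∂M.transKernel x := by
  have := hh.integrable (M.stepKernel π x)
  unfold stepKernel at this ⊢
  rw [ProbabilityTheory.integral_compProd this]
  rfl

instance isProbabilityMeasure_init (M : MDP S ν d) :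
    IsProbabilityMeasure (ν.withDensity fun s => ENNReal.ofReal (M.init s)) := by
  refine ⟨?_⟩
  rw [withDensity_apply _ MeasurableSet.univ, Measure.restrict_univ,
    ← ofReal_integral_eq_lintegral_ofReal (integrable_of_integral_eq_one M.integral_init)
      (ae_of_all _ M.init_nonneg), M.integral_init, ENNReal.ofReal_one]

instance : IsProbabilityMeasure (M.law π) := by
  rw [law, trajLaw_eq_chainLaw]; infer_instance

/-- The law of `S_t` under the policy `π`. -/
noncomputable def stateLaw (M : MDP S ν d) (π : S → Vec d → ℝ) (t : ℕ) : Measure S :=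
  (M.law π).map fun ω => (ω t).1

instance (t : ℕ) : IsProbabilityMeasure (M.stateLaw π t) :=
  Measure.isProbabilityMeasure_map (Measurable.aemeasurable (by fun_prop))

lemma stateLaw_eq_fst (t : ℕ) :
    M.stateLaw π t = ((M.law π).map fun ω => ω t).fst := by
  rw [Measure.fst, Measure.map_map measurable_fst (measurable_pi_apply _)]; rfl

lemma law_map_zero :
    (M.law π).map (fun ω => ω 0) =
      (ν.withDensity fun s => ENNReal.ofReal (M.init s)) ⊗ₘ M.policyKernel π := by
  rw [law, trajLaw_eq_chainLaw, chainLaw_map_zero]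

lemma law_map_succ (t : ℕ) :
    (M.law π).map (fun ω => ω (t + 1)) =
      (M.transKernel ∘ₘ ((M.law π).map fun ω => ω t)) ⊗ₘ M.policyKernel π := by
  have : IsProbabilityMeasure ((M.law π).map fun ω => ω t) :=
    Measure.isProbabilityMeasure_map (Measurable.aemeasurable (by fun_prop))
  rw [← stepKernel_comp, law, trajLaw_eq_chainLaw, chainLaw_map_succ]

lemma law_map (t : ℕ) :
    (M.law π).map (fun ω => ω t) = M.stateLaw π t ⊗ₘ M.policyKernel π := by
  cases t with
  | zero => rw [stateLaw_eq_fst, law_map_zero, Measure.fst_compProd]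
  | succ t =>
    have : IsProbabilityMeasure ((M.law π).map fun ω => ω t) :=
      Measure.isProbabilityMeasure_map (Measurable.aemeasurable (by fun_prop))
    rw [stateLaw_eq_fst, law_map_succ, Measure.fst_compProd]

lemma stateLaw_zero :
    M.stateLaw π 0 = ν.withDensity fun s => ENNReal.ofReal (M.init s) := by
  rw [stateLaw_eq_fst, law_map_zero, Measure.fst_compProd]

lemma stateLaw_succ (t : ℕ) :
    M.stateLaw π (t + 1) = M.transKernel ∘ₘ (M.stateLaw π t ⊗ₘ M.policyKernel π) := by
  have : IsProbabilityMeasure ((M.law π).map fun ω => ω t) :=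
    Measure.isProbabilityMeasure_map (Measurable.aemeasurable (by fun_prop))
  rw [stateLaw_eq_fst, law_map_succ, Measure.fst_compProd, law_map]

/-- The expected value of `h` after one step from the state `s` under `π`. -/
noncomputable def stateStep {F : Type*} [NormedAddCommGroup F] [NormedSpace ℝ F]
    (M : MDP S ν d) (π : S → Vec d → ℝ) (h : S → F) (s : S) : F :=
  ∫ a, ∫ s', h s' ∂M.transKernel (s, a) ∂M.policyKernel π s

section
variable {F : Type*} [NormedAddCommGroup F] [NormedSpace ℝ F] {h : S → F}

lemma _root_.BddMeas.stateStep (hh : BddMeas h) : BddMeas (M.stateStep π h) := by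
  have h1 := hh.integral_kernel M.transKernel
  exact h1.integral_kernel_prod (M.policyKernel π)

lemma integral_stateLaw_succ (hh : BddMeas h) (t : ℕ) :
    ∫ s, h s ∂M.stateLaw π (t + 1) = ∫ s, M.stateStep π h s ∂M.stateLaw π t := by
  rw [stateLaw_succ, hh.integral_measure_comp,
    Measure.integral_compProd ((hh.integral_kernel M.transKernel).integrable _)]
  rfl

/-- `S_0` has density `d₀`, and every later `S_t` has a density that averages transition densities;
both are bounded by compactness. The bound depends neither on `t` nor on the policy, which makes a
multiple of `ν` a common dominating measure. -/
lemma stateLaw_le (hM : M.Regular) :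
    ∃ C : ENNReal, C ≠ ⊤ ∧ ∀ (π : S → Vec d → ℝ) [IsMarkovKernel (M.policyKernel π)] (t : ℕ),
      M.stateLaw π t ≤ C • ν := by
  obtain ⟨C, hC0, hC⟩ := hM.exists_trans_le
  obtain ⟨D, hD0, hD⟩ := hM.exists_init_le
  refine ⟨ENNReal.ofReal (C + D), ENNReal.ofReal_ne_top, fun π _ t => ?_⟩
  refine Measure.le_iff.2 fun B hB => ?_
  rw [Measure.smul_apply, smul_eq_mul]
  have key : ∀ g : S → ℝ, (∀ s, g s ≤ C + D) →
      ∫⁻ s in B, ENNReal.ofReal (g s) ∂ν ≤ ENNReal.ofReal (C + D) * ν B := fun g hg =>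
    (lintegral_mono fun s => ENNReal.ofReal_le_ofReal (hg s)).trans_eq (by simp)
  cases t with
  | zero =>
    rw [stateLaw_zero, withDensity_apply _ hB]
    exact key _ fun s => (hD s).trans (by linarith)
  | succ t =>
    rw [stateLaw_succ, Measure.bind_apply hB (Kernel.aemeasurable _)]
    refine (lintegral_mono fun x => (?_ : _ ≤ ENNReal.ofReal (C + D) * ν B)).trans_eq (by simp)
    rw [transKernel, Kernel.withDensity_apply _ hM.measurable_trans, Kernel.const_apply,
      withDensity_apply _ hB]
    exact key _ fun s' => (hC x.1 x.2 x.2.2 s').trans (by linarith)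

lemma occupancy_eq_sum : M.occupancy π =
    Measure.sum fun t : ℕ => ENNReal.ofReal (M.discount ^ t) • M.stateLaw π t := rfl

instance : IsFiniteMeasure (M.occupancy π) := by
  refine ⟨?_⟩
  rw [occupancy_eq_sum, Measure.sum_apply _ MeasurableSet.univ]
  simp only [Measure.smul_apply, measure_univ, smul_eq_mul, mul_one, sum_ofReal_discount]
  exact ENNReal.ofReal_lt_top

lemma exists_occupancy_le (hM : M.Regular) :
    ∃ C : ENNReal, C ≠ ⊤ ∧ ∀ (π : S → Vec d → ℝ) [IsMarkovKernel (M.policyKernel π)],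
      M.occupancy π ≤ C • ν := by
  obtain ⟨C, hC, h⟩ := stateLaw_le (M := M) hM
  refine ⟨ENNReal.ofReal (1 - M.discount)⁻¹ * C, ENNReal.mul_ne_top ENNReal.ofReal_ne_top hC,
    fun π _ => Measure.le_iff.2 fun B hB => ?_⟩
  rw [occupancy_eq_sum, Measure.sum_apply _ hB, Measure.smul_apply, smul_eq_mul,
    ← sum_ofReal_discount, mul_assoc, ← ENNReal.tsum_mul_right]
  exact ENNReal.tsum_le_tsum fun t => mul_le_mul_right (h π t B) _

lemma hasSum_integral_occupancy (hh : BddMeas h) :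
    HasSum (fun t : ℕ => M.discount ^ t • ∫ s, h s ∂M.stateLaw π t)
      (∫ s, h s ∂M.occupancy π) := by
  have := hh.integrable (M.occupancy π)
  rw [occupancy_eq_sum] at this ⊢
  convert hasSum_integral_measure this using 2 with t
  rw [integral_smul_measure, ENNReal.toReal_ofReal (pow_nonneg M.discount_nonneg t)]

/-- The occupancy measure solves the flow equation `d_π = d₀ + γ d_π P_π`. -/
lemma integral_occupancy_flow (hh : BddMeas h) :
    ∫ s, h s ∂M.occupancy π = ∫ s, h s ∂(ν.withDensity fun s => ENNReal.ofReal (M.init s)) +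
      M.discount • ∫ s, M.stateStep π h s ∂M.occupancy π := by
  -- In an incomplete space all Bochner integrals are `0` by convention, so both sides vanish.
  by_cases hF : CompleteSpace F; swap
  · simp [integral, hF]
  have h1 := hasSum_integral_occupancy (M := M) (π := π) hh
  have h2 := (hasSum_integral_occupancy (M := M) (π := π)
    (hh.stateStep (M := M) (π := π))).const_smul M.discount
  rw [← stateLaw_zero (M := M) (π := π)]
  refine h1.unique ?_
  rw [add_comm]
  -- Without its term `t = 0`, the series for `d_π` is `γ` times the series of the one-step
  -- expectations.
  refine (hasSum_nat_add_iff' 1).1 ?_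
  simpa [integral_stateLaw_succ hh, pow_succ', mul_smul] using h2

end

end ControlledChain

end MDP

/-! ### Soft value functions, the Bellman equation and the performance difference formula. -/

namespace MDP

variable {S : Type*} [MetricSpace S] [CompactSpace S] [MeasurableSpace S] [BorelSpace S]
  {ν : Measure S} [IsFiniteMeasure ν] {d : ℕ} {M : MDP S ν d} {π : S → Vec d → ℝ}

/-- The one-step soft reward `r(s, a) + α γ E[H(π(· | S₁)) | s, a]`. -/
noncomputable def softReward (M : MDP S ν d) (α : ℝ) (π : S → Vec d → ℝ) (x : S × M.A) : ℝ :=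
  M.reward x.1 x.2 + α * M.discount * ∫ s', M.entropy π s' ∂M.transKernel x

/-- The soft action-value function as a function on the state-action pairs. -/
noncomputable def actionValue (M : MDP S ν d) (α : ℝ) (π : S → Vec d → ℝ) : S × M.A → ℝ :=
  discountedResolvent (M.stepKernel π) M.discount (M.softReward α π)

/-- The soft state-value function. -/
noncomputable def stateValue (M : MDP S ν d) (α : ℝ) (π : S → Vec d → ℝ) (s : S) : ℝ :=
  ∫ a, M.actionValue α π (s, a) ∂M.policyKernel π s + α * M.entropy π s

/-- The extension of the soft action-value function to all `a : ℝᵈ` that is given by the Bellman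
equation. -/
noncomputable def bellmanQ (M : MDP S ν d) (α : ℝ) (π : S → Vec d → ℝ) (s : S) (a : Vec d) : ℝ :=
  M.reward s a + M.discount * ∫ s', M.trans s a s' • M.stateValue α π s' ∂ν

variable (hM : M.Regular) (hπ : M.IsPolicy π) (α : ℝ)

include hM hπ

lemma IsPolicy.bddMeas_softReward : BddMeas (M.softReward α π) := by
  have := hM.isMarkovKernel_transKernel
  exact hM.bddMeas_reward.add ((hπ.entropy.integral_kernel M.transKernel).const_mul _)

lemma IsPolicy.bddMeas_actionValue : BddMeas (M.actionValue α π) := by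
  have := hM.isMarkovKernel_transKernel
  have := hπ.isMarkovKernel_policyKernel
  exact (hπ.bddMeas_softReward hM α).discountedResolvent M.discount_nonneg M.discount_lt_one

lemma IsPolicy.bddMeas_stateValue : BddMeas (M.stateValue α π) := by
  have := hπ.isMarkovKernel_policyKernel
  have hq := hπ.bddMeas_actionValue hM α
  exact (hq.integral_kernel_prod (M.policyKernel π)).add (hπ.entropy.const_mul α)

/-- The entropy of the next state in `softReward` is the part of `stateValue` missing from the
averaged action value, so both merge into one integral of `stateValue`. -/
lemma IsPolicy.actionValue_eq (x : S × M.A) :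
    M.actionValue α π x = M.bellmanQ α π x.1 x.2 := by
  have := hM.isMarkovKernel_transKernel
  have := hπ.isMarkovKernel_policyKernel
  have hq := hπ.bddMeas_actionValue hM α
  have h1 : BddMeas fun s => ∫ a, M.actionValue α π (s, a) ∂M.policyKernel π s :=
    hq.integral_kernel_prod (M.policyKernel π)
  have h2 : M.actionValue α π x = M.softReward α π x +
      M.discount * ∫ y, M.actionValue α π y ∂M.stepKernel π x :=
    discountedResolvent_eq (hπ.bddMeas_softReward hM α) M.discount_nonneg M.discount_lt_one x
  rw [h2, integral_stepKernel hq, bellmanQ, ← hM.integral_transKernel, softReward]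
  unfold stateValue
  rw [integral_add (h1.integrable _) ((hπ.entropy.const_mul α).integrable _),
    integral_const_mul]
  ring

/-- The two series agree term by term: the marginals evolve by the step kernel from a Dirac mass,
and averaging the entropy at time `t + 1` over one step gives `softReward` at time `t`. Off `A`,
`softQ` is `0` by definition, so smoothness in the action is read off `bellmanQ`. -/
lemma IsPolicy.softQ_eq (s : S) {a : Vec d} (ha : a ∈ M.A) :
    M.softQ α π s a = M.bellmanQ α π s a := by
  have := hM.isMarkovKernel_transKernel
  have := hπ.isMarkovKernel_policyKernel
  rw [← hπ.actionValue_eq hM α (s, ⟨a, ha⟩), softQ, dif_pos ha, trajLaw_eq_chainLaw, actionValue,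
    discountedResolvent]
  set μ₀ : Measure (S × M.A) := Measure.dirac (s, ⟨a, ha⟩)
  set L := chainLaw (M.stepKernel π) μ₀
  set m : ℕ → Measure (S × M.A) := fun t => L.map fun ω => ω t with hm
  have hmp : ∀ t, IsProbabilityMeasure (m t) := fun t =>
    Measure.isProbabilityMeasure_map (measurable_pi_apply t).aemeasurable
  have hm0 : m 0 = μ₀ := chainLaw_map_zero _ _
  have hmsucc : ∀ t, m (t + 1) = M.stepKernel π ∘ₘ m t := chainLaw_map_succ _ _
  have hr := hM.bddMeas_reward
  have hH : BddMeas fun x : S × M.A => M.entropy π x.1 := hπ.entropy.comp measurable_fst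
  have hb : ∀ t, BddMeas fun ω : ℕ → S × M.A => M.reward (ω t).1 (ω t).2 +
      α * M.discount * M.entropy π (ω (t + 1)).1 := fun t =>
    (hr.comp (measurable_pi_apply t)).add ((hH.comp (measurable_pi_apply (t + 1))).const_mul _)
  obtain ⟨C, hC⟩ := hr.2
  obtain ⟨D, hD⟩ := hH.2
  rw [integral_tsum_discounted M.discount_nonneg M.discount_lt_one (C := C + ‖α * M.discount‖ * D)
    (fun t => (hb t).1)]
  swap
  · intro t ω
    refine (norm_add_le _ _).trans (add_le_add (hC _) ?_)
    rw [norm_mul]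
    exact mul_le_mul_of_nonneg_left (hD (ω (t + 1))) (norm_nonneg _)
  refine tsum_congr fun t => ?_
  congr 1
  have h1 : ∫ x, M.softReward α π x ∂m t =
      ∫ x, ((kernelAct (M.stepKernel π))^[t] (M.softReward α π)) x ∂m 0 :=
    integral_eq_integral_iterate hmsucc t (hπ.bddMeas_softReward hM α)
  have hs := ((hπ.bddMeas_softReward hM α).kernelAct_iterate (K := M.stepKernel π) t).1
  rw [hm0, integral_dirac' _ _ hs] at h1
  rw [← h1, integral_add ((hr.comp (measurable_pi_apply t)).integrable L)
    (((hH.comp (measurable_pi_apply (t + 1))).const_mul _).integrable L), integral_const_mul]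
  have e1 : ∫ ω, M.reward (ω t).1 (ω t).2 ∂L = ∫ x, M.reward x.1 x.2 ∂m t :=
    (hr.integral_map (measurable_pi_apply t) L).symm
  have e2 : ∫ ω, M.entropy π (ω (t + 1)).1 ∂L = ∫ x, M.entropy π x.1 ∂m (t + 1) :=
    (hH.integral_map (measurable_pi_apply (t + 1)) L).symm
  have hT := hπ.entropy.integral_kernel M.transKernel
  rw [e1, e2, hmsucc, hH.integral_measure_comp]
  unfold softReward
  rw [integral_add (hr.integrable _) ((hT.const_mul _).integrable _), integral_const_mul]
  congr 3 with x
  rw [integral_stepKernel hH]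
  simp

lemma IsPolicy.objective_eq : M.objective α π =
    ∫ s, (∫ a, M.reward s a ∂M.policyKernel π s) + α * M.entropy π s ∂M.occupancy π := by
  have := hM.isMarkovKernel_transKernel
  have := hπ.isMarkovKernel_policyKernel
  have hr := hM.bddMeas_reward
  have hc : BddMeas fun x : S × M.A => M.reward x.1 x.2 + α * M.entropy π x.1 :=
    hr.add ((hπ.entropy.comp measurable_fst).const_mul α)
  have hr' : BddMeas fun s => ∫ a, M.reward s a ∂M.policyKernel π s :=
    hr.integral_kernel_prod (M.policyKernel π)
  obtain ⟨C, hC⟩ := hc.2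
  rw [objective, integral_tsum_discounted M.discount_nonneg M.discount_lt_one
      (f := fun t (ω : ℕ → S × M.A) => M.reward (ω t).1 (ω t).2 + α * M.entropy π (ω t).1)
      (fun t => (hc.comp (measurable_pi_apply t)).1) (fun t ω => hC (ω t)),
    ← (hasSum_integral_occupancy (hr'.add (hπ.entropy.const_mul α))).tsum_eq]
  refine tsum_congr fun t => ?_
  rw [smul_eq_mul]
  congr 1
  have e1 : ∫ ω, M.reward (ω t).1 (ω t).2 + α * M.entropy π (ω t).1 ∂M.law π =
      ∫ x, M.reward x.1 x.2 + α * M.entropy π x.1 ∂(M.law π).map (fun ω => ω t) :=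
    (hc.integral_map (measurable_pi_apply t) _).symm
  rw [e1, law_map, Measure.integral_compProd (hc.integrable _)]
  congr 1 with s
  have hrs : BddMeas fun a : M.A => M.reward s a := hr.comp measurable_prodMk_left
  refine (integral_add (hrs.integrable (M.policyKernel π s))
    (integrable_const (α * M.entropy π s))).trans ?_
  simp

/-- The expected Bellman value of the action distribution `π'` at the state `s`, when the process is
continued with `π`. -/
noncomputable def lookahead (M : MDP S ν d) (α : ℝ) (π π' : S → Vec d → ℝ) (s : S) : ℝ :=
  (∫ a in M.A, π' s a * M.bellmanQ α π s a) + α * M.entropy π' s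

lemma IsPolicy.bddMeas_bellmanQ : BddMeas fun x : S × M.A => M.bellmanQ α π x.1 x.2 := by
  have h : M.actionValue α π = fun x => M.bellmanQ α π x.1 x.2 :=
    funext fun x => hπ.actionValue_eq hM α x
  exact h ▸ hπ.bddMeas_actionValue hM α

/-- This exposes the term `γ P_{π'} V_π`, which the flow equation of `d_{π'}` cancels. -/
lemma IsPolicy.lookahead_eq {π' : S → Vec d → ℝ} (hπ' : M.IsPolicy π') (s : S) :
    M.lookahead α π π' s =
      ((∫ a, M.reward s a ∂M.policyKernel π' s) + α * M.entropy π' s) +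
        M.discount * M.stateStep π' (M.stateValue α π) s := by
  have := hM.isMarkovKernel_transKernel
  have := hπ'.isMarkovKernel_policyKernel
  have hr : BddMeas fun a : M.A => M.reward s a := hM.bddMeas_reward.comp measurable_prodMk_left
  have hV : BddMeas fun a : M.A => ∫ s', M.stateValue α π s' ∂M.transKernel (s, a) :=
    ((hπ.bddMeas_stateValue hM α).integral_kernel M.transKernel).comp measurable_prodMk_left
  have e := hπ'.integral_policyKernel (fun a => M.bellmanQ α π s a) s
  simp only [smul_eq_mul] at e
  rw [lookahead, ← e]
  simp only [bellmanQ]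
  simp_rw [← fun a : M.A => hM.integral_transKernel (M.stateValue α π) (s, a)]
  rw [integral_add (hr.integrable _) ((hV.const_mul _).integrable _), integral_const_mul, stateStep]
  ring

lemma IsPolicy.lookahead_self (s : S) : M.lookahead α π π s = M.stateValue α π s := by
  have e := hπ.integral_policyKernel (fun a => M.bellmanQ α π s a) s
  simp only [smul_eq_mul] at e
  rw [lookahead, ← e, stateValue]
  simp only [hπ.actionValue_eq hM α]

lemma IsPolicy.bddMeas_lookahead {π' : S → Vec d → ℝ} (hπ' : M.IsPolicy π') :
    BddMeas (M.lookahead α π π') := by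
  have := hπ'.isMarkovKernel_policyKernel
  refine BddMeas.add ?_ (hπ'.entropy.const_mul α)
  have hq := hπ.bddMeas_bellmanQ hM α
  have e := fun s => hπ'.integral_policyKernel (fun a => M.bellmanQ α π s a) s
  simp only [smul_eq_mul] at e
  simp only [← e]
  exact hq.integral_kernel_prod (M.policyKernel π')

/-- The performance difference formula. -/
lemma IsPolicy.objective_sub {π' : S → Vec d → ℝ} (hπ' : M.IsPolicy π') :
    M.objective α π' - M.objective α π =
      ∫ s, M.lookahead α π π' s - M.lookahead α π π s ∂M.occupancy π' := by
  have := hM.isMarkovKernel_transKernel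
  -- With `V_π` as baseline the left side is `0` for `ρ = π`, so this one identity also yields `J(π)
  -- = ∫ V_π d₀`.
  have key : ∀ ρ : S → Vec d → ℝ, M.IsPolicy ρ →
      ∫ s, M.lookahead α π ρ s - M.stateValue α π s ∂M.occupancy ρ = M.objective α ρ -
        ∫ s, M.stateValue α π s ∂(ν.withDensity fun s => ENNReal.ofReal (M.init s)) := by
    intro ρ hρ
    have := hρ.isMarkovKernel_policyKernel
    have hV := hπ.bddMeas_stateValue hM α
    have hr' : BddMeas fun s => ∫ a, M.reward s a ∂M.policyKernel ρ s :=
      hM.bddMeas_reward.integral_kernel_prod (M.policyKernel ρ)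
    -- The flow equation is applied to `V_π`, which leaves only `∫ V_π d₀` and the soft reward
    -- integrated against `d_ρ`.
    rw [integral_sub ((hπ.bddMeas_lookahead hM α hρ).integrable _) (hV.integrable _),
      integral_occupancy_flow hV, hρ.objective_eq hM]
    simp_rw [hπ.lookahead_eq hM α hρ]
    rw [integral_add ((hr'.add (hρ.entropy.const_mul α)).integrable _)
      ((hV.stateStep.const_mul _).integrable _), integral_const_mul, smul_eq_mul]
    ring
  simp_rw [hπ.lookahead_self hM α]
  have h0 := key π hπ
  simp_rw [hπ.lookahead_self hM α] at h0
  simp only [sub_self, integral_zero] at h0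
  rw [key π' hπ']
  linarith

end MDP

/-! ### Differentiating an integral against a varying measure -/

/-- If the measures `μ θ'` are dominated by a fixed finite measure and `∫ G ∂(μ θ')` is continuous
at `θ`, then `∫ (g θ' - g θ) ∂(μ θ')` has the derivative `∫ G ∂(μ θ)` at `θ`, where `G` is the
pointwise derivative of `g`. -/
lemma hasFDerivAt_integral_sub_of_dominated {E S : Type*} [NormedAddCommGroup E] [NormedSpace ℝ E]
    [MeasurableSpace S] {ν : Measure S} [IsFiniteMeasure ν] {μ : E → Measure S}
    {C : ENNReal} (hC : C ≠ ⊤) {θ : E} (hμ : ∀ᶠ θ' in 𝓝 θ, μ θ' ≤ C • ν)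
    {g : E → S → ℝ} {G : S → E →L[ℝ] ℝ} (hg : ∀ᶠ θ' in 𝓝 θ, BddMeas (g θ'))
    (hG : BddMeas G) {L : ℝ} (hL0 : 0 ≤ L)
    (hL : ∀ᶠ θ' in 𝓝 θ, ∀ s, ‖g θ' s - g θ s‖ ≤ L * ‖θ' - θ‖)
    (hd : ∀ s, HasFDerivAt (fun θ' => g θ' s) (G s) θ)
    (ht : Tendsto (fun θ' => ∫ s, G s ∂μ θ') (𝓝 θ) (𝓝 (∫ s, G s ∂μ θ))) :
    HasFDerivAt (fun θ' => ∫ s, g θ' s - g θ s ∂μ θ') (∫ s, G s ∂μ θ) θ := by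
  have hfin : IsFiniteMeasure (C • ν) := ν.smul_finite hC
  obtain ⟨K, hK0, hK⟩ := hG.exists_bound
  -- The normalized Taylor remainder of `g`; it is `0` at `θ' = θ` since `0⁻¹ = 0`.
  set R : E → S → ℝ := fun θ' s => ‖θ' - θ‖⁻¹ * ‖g θ' s - g θ s - G s (θ' - θ)‖ with hR
  have hgθ := hg.self_of_nhds
  have hRm : ∀ θ', BddMeas (g θ') → BddMeas (fun s => g θ' s - g θ s - G s (θ' - θ)) := by
    intro θ' h
    obtain ⟨C1, h1⟩ := h.2
    obtain ⟨C2, h2⟩ := hgθ.2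
    refine ⟨(h.1.sub hgθ.1).sub ((ContinuousLinearMap.apply ℝ ℝ (θ' - θ)).continuous.comp_stronglyMeasurable hG.1), C1 + C2 + K * ‖θ' - θ‖,
      fun s => ?_⟩
    refine (norm_sub_le _ _).trans (add_le_add ((norm_sub_le _ _).trans
      (add_le_add (h1 s) (h2 s))) ?_)
    exact ((G s).le_opNorm _).trans (mul_le_mul_of_nonneg_right (hK s) (norm_nonneg _))
  -- Dominated convergence takes place under the fixed measure `ν`, with bound `L + K` from the
  -- Lipschitz estimate and `‖G‖ ≤ K`. The domination `μ θ' ≤ C • ν` then transfers the limit to the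
  -- varying measures.
  have hRlim : Tendsto (fun θ' => ∫ s, R θ' s ∂ν) (𝓝 θ) (𝓝 0) := by
    have := tendsto_integral_filter_of_dominated_convergence (μ := ν) (F := R) (f := fun _ => 0)
      (l := 𝓝 θ) (fun _ => L + K) ?_ ?_ (integrable_const _) ?_
    · simpa using this
    · filter_upwards [hg] with θ' h
      exact ((hRm θ' h).1.norm.const_mul _).aestronglyMeasurable
    · filter_upwards [hL] with θ' h
      refine ae_of_all _ fun s => ?_
      rw [hR, Real.norm_of_nonneg (by positivity)]
      rcases eq_or_ne θ' θ with rfl | hne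
      · simp only [sub_self, norm_zero, inv_zero, zero_mul]
        positivity
      · rw [inv_mul_le_iff₀ (norm_pos_iff.2 (sub_ne_zero.2 hne)), mul_add, mul_comm _ L,
          mul_comm _ K]
        exact (norm_sub_le _ _).trans (add_le_add (h s) (((G s).le_opNorm _).trans
          (mul_le_mul_of_nonneg_right (hK s) (norm_nonneg _))))
    · exact ae_of_all _ fun s => hasFDerivAt_iff_tendsto.1 (hd s)
  rw [hasFDerivAt_iff_tendsto]
  have hlim : Tendsto (fun θ' => C.toReal * ∫ s, R θ' s ∂ν +
      ‖(∫ s, G s ∂μ θ') - ∫ s, G s ∂μ θ‖) (𝓝 θ) (𝓝 0) := by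
    have h2 := (tendsto_iff_norm_sub_tendsto_zero.1 ht)
    simpa using (hRlim.const_mul C.toReal).add h2
  refine tendsto_of_tendsto_of_tendsto_of_le_of_le' tendsto_const_nhds hlim
    (Eventually.of_forall fun θ' => by positivity) ?_
  filter_upwards [hg, hμ] with θ' h hm
  have : IsFiniteMeasure (μ θ') := isFiniteMeasure_of_le _ hm
  have hGi := hG.integrable (μ θ')
  have hrem := hRm θ' h
  have hGd : BddMeas fun s => G s (θ' - θ) :=
    ⟨(ContinuousLinearMap.apply ℝ ℝ (θ' - θ)).continuous.comp_stronglyMeasurable hG.1, K * ‖θ' - θ‖, fun s => ((G s).le_opNorm _).trans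
      (mul_le_mul_of_nonneg_right (hK s) (norm_nonneg _))⟩
  have hb : ∫ s, R θ' s ∂μ θ' ≤ C.toReal * ∫ s, R θ' s ∂ν := by
    have hRi : Integrable (R θ') (C • ν) := (hrem.integrable _).norm.const_mul _
    refine (integral_mono_measure hm (ae_of_all _ fun s => by positivity) hRi).trans_eq ?_
    rw [integral_smul_measure, smul_eq_mul]
  -- The error splits into the Taylor remainder under `μ θ'` and the change of `∫ G` caused by
  -- moving the measure.
  have e : (∫ s, g θ' s - g θ s ∂μ θ') - (∫ s, g θ s - g θ s ∂μ θ) - (∫ s, G s ∂μ θ) (θ' - θ) =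
      ∫ s, (g θ' s - g θ s - G s (θ' - θ)) ∂μ θ' +
        ((∫ s, G s ∂μ θ') - ∫ s, G s ∂μ θ) (θ' - θ) := by
    rw [integral_sub (f := fun s => g θ' s - g θ s)
        ((h.integrable _).sub (hgθ.integrable _)) (hGd.integrable _),
      sub_apply, ContinuousLinearMap.integral_apply hGi]
    simp
  rw [e]
  have hn : ‖θ' - θ‖⁻¹ * ‖θ' - θ‖ ≤ 1 := inv_mul_le_one
  calc ‖θ' - θ‖⁻¹ * ‖∫ s, (g θ' s - g θ s - G s (θ' - θ)) ∂μ θ' +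
        ((∫ s, G s ∂μ θ') - ∫ s, G s ∂μ θ) (θ' - θ)‖
      ≤ ‖θ' - θ‖⁻¹ * (∫ s, ‖g θ' s - g θ s - G s (θ' - θ)‖ ∂μ θ' +
        ‖(∫ s, G s ∂μ θ') - ∫ s, G s ∂μ θ‖ * ‖θ' - θ‖) := by
        gcongr
        exact (norm_add_le _ _).trans (add_le_add (norm_integral_le_integral_norm _)
          (ContinuousLinearMap.le_opNorm _ _))
    _ = ∫ s, R θ' s ∂μ θ' +
        ‖(∫ s, G s ∂μ θ') - ∫ s, G s ∂μ θ‖ * (‖θ' - θ‖⁻¹ * ‖θ' - θ‖) := by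
        rw [hR, integral_const_mul]; ring
    _ ≤ _ := add_le_add hb (mul_le_of_le_one_right (norm_nonneg _) hn)

/-! ### Uniqueness of derivatives within a measurable set -/

/-- At almost every point of a measurable set, linear functionals that are derivatives within the
set are unique. -/
lemma ae_eq_of_hasFDerivWithinAt {E : Type*} [NormedAddCommGroup E] [NormedSpace ℝ E]
    [FiniteDimensional ℝ E] [MeasurableSpace E] [BorelSpace E] (μ : Measure E)
    [μ.IsAddHaarMeasure] {A : Set E} (hA : MeasurableSet A) :
    ∀ᵐ a ∂μ.restrict A, ∀ (h : E → ℝ) (D D' : E →L[ℝ] ℝ),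
      HasFDerivWithinAt h D A a → HasFDerivWithinAt h D' A a → D = D' := by
  classical
  -- The zero map serves as a test: `f' a` is a nonzero derivative of it within `A` whenever one
  -- exists.
  set f' : E → E →L[ℝ] E := fun a =>
    if H : ∃ D : E →L[ℝ] E, HasFDerivWithinAt (fun _ => (0 : E)) D A a ∧ D ≠ 0
      then H.choose else 0
  have hf' : ∀ a ∈ A, HasFDerivWithinAt (fun _ => (0 : E)) (f' a) A a := by
    intro a _
    by_cases H : ∃ D : E →L[ℝ] E, HasFDerivWithinAt (fun _ => (0 : E)) D A a ∧ D ≠ 0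
    · simp only [f', dif_pos H]; exact H.choose_spec.1
    · simp only [f', dif_neg H]; exact hasFDerivWithinAt_const _ _ _
  have hlin : ApproximatesLinearOn (fun _ : E => (0 : E)) (0 : E →L[ℝ] E) A 0 := by
    intro x _ y _; simp
  -- The zero map is approximated by the linear map `0` with constant `0`, so any choice of its
  -- derivatives within `A` vanishes almost everywhere.
  filter_upwards [hlin.norm_fderiv_sub_le μ hA f' hf'] with a ha h D D' hD hD'
  have hz : HasFDerivWithinAt (fun _ => (0 : ℝ)) (D - D') A a := by
    simpa using! hD.sub hD'
  rw [← sub_eq_zero]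
  by_contra hne
  obtain ⟨v, hv⟩ : ∃ v, (D - D') v ≠ 0 := by
    by_contra! hcon
    exact hne (ContinuousLinearMap.ext hcon)
  have hv0 : v ≠ 0 := by rintro rfl; simp at hv
  have H : ∃ B : E →L[ℝ] E, HasFDerivWithinAt (fun _ => (0 : E)) B A a ∧ B ≠ 0 := by
    -- Distinct derivatives `D` and `D'` would give this nonzero rank-one derivative of the zero
    -- map, whose value at `v` is `(D - D') v • v`.
    refine ⟨(D - D').smulRight v, ?_, fun h0 => ?_⟩
    · simpa using! hz.smul_const v
    · have := congrArg (fun B : E →L[ℝ] E => B v) h0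
      simp only [ContinuousLinearMap.smulRight_apply, zero_apply,
        smul_eq_zero] at this
      exact this.elim hv hv0
  have h1 : f' a ≠ 0 := by simp only [f', dif_pos H]; exact H.choose_spec.2
  have h2 : f' a = 0 := by
    have := ha
    simpa using this
  exact h1 h2

/-! ### Families with jointly continuous partial derivatives -/

namespace ContC1

variable {S F : Type*} [TopologicalSpace S] [NormedAddCommGroup F] [NormedSpace ℝ F] {m d : ℕ}
  {Θ : Set (Vec m)} {g : Vec m → S → Vec d → F}

lemma continuousOn_fderiv_param (hg : ContC1 Θ g) :
    ContinuousOn (fun x : Vec m × S × Vec d => fderiv ℝ (fun θ => g θ x.2.1 x.2.2) x.1)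
      {x | x.1 ∈ Θ} :=
  hg.partial_param.2.comp (f := fun x : Vec m × S × Vec d => ((x.2.1, x.2.2), x.1))
    (by fun_prop) fun _ hx => hx

lemma continuousOn_fderiv_var (hg : ContC1 Θ g) :
    ContinuousOn (fun x : Vec m × S × Vec d => fderiv ℝ (g x.1 x.2.1) x.2.2) {x | x.1 ∈ Θ} :=
  hg.partial_var.2.comp (f := fun x : Vec m × S × Vec d => ((x.1, x.2.1), x.2.2))
    (by fun_prop) fun _ hx => hx

lemma hasFDerivAt_param (hg : ContC1 Θ g) {θ : Vec m} (hθ : θ ∈ Θ) (s : S) (v : Vec d) :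
    HasFDerivAt (fun θ' => g θ' s v) (fderiv ℝ (fun θ' => g θ' s v) θ) θ :=
  (hg.partial_param.1 ((s, v), θ) hθ).hasFDerivAt

lemma hasFDerivAt_var (hg : ContC1 Θ g) {θ : Vec m} (hθ : θ ∈ Θ) (s : S) (v : Vec d) :
    HasFDerivAt (g θ s) (fderiv ℝ (g θ s) v) v :=
  (hg.partial_var.1 ((θ, s), v) hθ).hasFDerivAt

/-- The chain rule for `θ' ↦ g θ' s (u θ')`. -/
lemma hasFDerivAt_comp (hg : ContC1 Θ g) (hΘ : IsOpen Θ) {θ : Vec m} (hθ : θ ∈ Θ) (s : S)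
    {u : Vec m → Vec d} {u' : Vec m →L[ℝ] Vec d} (hu : HasFDerivAt u u' θ) :
    HasFDerivAt (fun θ' => g θ' s (u θ'))
      (fderiv ℝ (fun θ' => g θ' s (u θ)) θ + (fderiv ℝ (g θ s) (u θ)).comp u') θ := by
  have hopen : IsOpen {x : Vec m × Vec d | x.1 ∈ Θ} := hΘ.preimage continuous_fst
  have hmem : ∀ᶠ v : Vec m × Vec d in 𝓝 (θ, u θ), v.1 ∈ Θ := hopen.mem_nhds hθ
  -- Jointly continuous partial derivatives make `g` strictly differentiable in `(θ, v)` together.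
  have h := hasStrictFDerivAt_uncurry_coprod (𝕜 := ℝ) (u := (θ, u θ))
    (f := fun θ' v => g θ' s v) (f₁ := fun θ' v => fderiv ℝ (fun θ' => g θ' s v) θ')
    (f₂ := fun θ' v => fderiv ℝ (g θ' s) v)
    (hmem.mono fun v hv => hg.hasFDerivAt_param hv s v.2)
    (hmem.mono fun v hv => hg.hasFDerivAt_var hv s v.2)
    ((hg.continuousOn_fderiv_param.comp (f := fun x : Vec m × Vec d => (x.1, s, x.2))
      (by fun_prop) fun _ hx => hx).continuousAt (hopen.mem_nhds hθ))
    ((hg.continuousOn_fderiv_var.comp (f := fun x : Vec m × Vec d => (x.1, s, x.2))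
      (by fun_prop) fun _ hx => hx).continuousAt (hopen.mem_nhds hθ))
  have h2 := h.hasFDerivAt.comp θ ((hasFDerivAt_id θ).prodMk hu)
  refine h2.congr_fderiv (ContinuousLinearMap.ext fun x => ?_)
  simp [Function.HasUncurry.uncurry]

lemma continuous_of_mem (hg : ContC1 Θ g) {θ : Vec m} (hθ : θ ∈ Θ) :
    Continuous fun x : S × Vec d => g θ x.1 x.2 :=
  hg.continuousOn.comp_continuous (f := fun x : S × Vec d => (θ, x.1, x.2)) (by fun_prop)
    fun _ => hθ

end ContC1

/-! ### Mixture policies -/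

namespace ReparamMixture

variable {S : Type*} [MetricSpace S] [CompactSpace S] [MeasurableSpace S] [BorelSpace S]
  {m N d : ℕ} {P : ReparamMixture S m N d} {A : Set (Vec d)}

lemma Regular.hasFDerivAt_weight (hreg : P.Regular) {θ : Vec m} (hθ : θ ∈ P.Θ) (s : S)
    (k : Fin N) :
    HasFDerivAt (fun θ' => P.weight θ' s k) (fderiv ℝ (fun θ' => P.weight θ' s k) θ) θ :=
  ((hreg.partial_weight k).1 (s, θ) hθ).hasFDerivAt

lemma Regular.continuousOn_fderiv_weight (hreg : P.Regular) (k : Fin N) :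
    ContinuousOn (fun x : Vec m × S => fderiv ℝ (fun θ' => P.weight θ' x.2 k) x.1)
      {x | x.1 ∈ P.Θ} :=
  (hreg.partial_weight k).2.comp (f := fun x : Vec m × S => (x.2, x.1)) (by fun_prop)
    fun _ hx => hx

lemma Regular.contC1_mixture (hreg : P.Regular) : ContC1 P.Θ P.mixture := by
  have hw : ∀ k, ContinuousOn (fun x : Vec m × S × Vec d => P.weight x.1 x.2.1 k)
      {x | x.1 ∈ P.Θ} := fun k =>
    (hreg.continuousOn_weight k).comp (f := fun x : Vec m × S × Vec d => (x.1, x.2.1))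
      (by fun_prop) fun _ hx => hx
  have hdw : ∀ k, ContinuousOn (fun x : Vec m × S × Vec d =>
      fderiv ℝ (fun θ' => P.weight θ' x.2.1 k) x.1) {x | x.1 ∈ P.Θ} := fun k =>
    (hreg.continuousOn_fderiv_weight k).comp (f := fun x : Vec m × S × Vec d => (x.1, x.2.1))
      (by fun_prop) fun _ hx => hx
  have hparam : ∀ θ ∈ P.Θ, ∀ s a, HasFDerivAt (fun θ' => P.mixture θ' s a)
      (∑ k, (P.weight θ s k • fderiv ℝ (fun θ' => P.comp θ' s k a) θ +
        P.comp θ s k a • fderiv ℝ (fun θ' => P.weight θ' s k) θ)) θ := fun θ hθ s a =>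
    HasFDerivAt.fun_sum fun k _ =>
      (hreg.hasFDerivAt_weight hθ s k).mul ((hreg.comp k).hasFDerivAt_param hθ s a)
  have hvar : ∀ θ ∈ P.Θ, ∀ s a, HasFDerivAt (P.mixture θ s)
      (∑ k, P.weight θ s k • fderiv ℝ (P.comp θ s k) a) a := fun θ hθ s a =>
    HasFDerivAt.fun_sum fun k _ => ((hreg.comp k).hasFDerivAt_var hθ s a).const_mul _
  refine ⟨?_, ⟨fun z hz => (hparam z.2 hz z.1.1 z.1.2).differentiableAt, ?_⟩,
    ⟨fun z hz => (hvar z.1.1 hz z.1.2 z.2).differentiableAt, ?_⟩⟩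
  · exact continuousOn_finsetSum _ fun k _ => (hw k).mul (hreg.comp k).continuousOn
  · have : ContinuousOn (fun x : Vec m × S × Vec d =>
        ∑ k, (P.weight x.1 x.2.1 k • fderiv ℝ (fun θ' => P.comp θ' x.2.1 k x.2.2) x.1 +
        P.comp x.1 x.2.1 k x.2.2 • fderiv ℝ (fun θ' => P.weight θ' x.2.1 k) x.1))
        {x | x.1 ∈ P.Θ} :=
      continuousOn_finsetSum _ fun k _ => ((hw k).smul (hreg.comp k).continuousOn_fderiv_param).add
        ((hreg.comp k).continuousOn.smul (hdw k))
    refine (this.comp (f := fun z : (S × Vec d) × Vec m => (z.2, z.1.1, z.1.2)) (by fun_prop)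
      fun _ hx => hx).congr fun z hz => (hparam z.2 hz z.1.1 z.1.2).fderiv
  · have : ContinuousOn (fun x : Vec m × S × Vec d =>
        ∑ k, P.weight x.1 x.2.1 k • fderiv ℝ (P.comp x.1 x.2.1 k) x.2.2) {x | x.1 ∈ P.Θ} :=
      continuousOn_finsetSum _ fun k _ => (hw k).smul (hreg.comp k).continuousOn_fderiv_var
    refine (this.comp (f := fun z : (Vec m × S) × Vec d => (z.1.1, z.1.2, z.2)) (by fun_prop)
      fun _ hx => hx).congr fun z hz => (hvar z.1.1 hz z.1.2 z.2).fderiv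

lemma Regular.measurable_f (hreg : P.Regular) {θ : Vec m} (hθ : θ ∈ P.Θ) (k : Fin N) :
    Measurable fun x : S × Vec d => P.f θ x.1 k x.2 :=
  ((hreg.f k).continuous_of_mem hθ).measurable

namespace IsPolicyOn

variable (hP : P.IsPolicyOn A)
include hP

lemma mixture_nonneg {θ : Vec m} (hθ : θ ∈ P.Θ) (s : S) {a : Vec d} (ha : a ∈ A) :
    0 ≤ P.mixture θ s a :=
  Finset.sum_nonneg fun k _ => mul_nonneg (hP.weight_pos θ hθ s k).le (hP.comp_nonneg θ hθ s k a ha)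

/-- `E` is the image of `A` under the continuous inverse reparameterization. Its measurability is
obtained from this too. -/
lemma isCompact_E (hreg : P.Regular) (hA : IsCompact A) {θ : Vec m} (hθ : θ ∈ P.Θ) (s : S)
    (k : Fin N) : IsCompact P.E := by
  have h : P.E = P.finv θ s k '' A := by
    refine Set.Subset.antisymm (fun ε hε => ⟨P.f θ s k ε, hP.mapsTo θ hθ s k hε,
      (hP.invOn θ hθ s k).1 hε⟩) ?_
    rintro _ ⟨a, ha, rfl⟩
    exact hP.mapsTo_inv θ hθ s k ha
  rw [h]
  refine hA.image ?_
  exact ((hreg.finv k).continuous_of_mem hθ).comp (by fun_prop : Continuous fun a => (s, a))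

lemma isProbabilityMeasure_noiseLaw (hE : MeasurableSet P.E) :
    IsProbabilityMeasure P.noiseLaw := by
  refine ⟨?_⟩
  rw [noiseLaw, withDensity_apply _ MeasurableSet.univ, Measure.restrict_univ,
    ← ofReal_integral_eq_lintegral_ofReal (integrable_of_integral_eq_one hP.integral_noise)
      ((ae_restrict_iff' hE).2 (ae_of_all _ hP.noise_nonneg)), hP.integral_noise,
    ENNReal.ofReal_one]

variable (hreg : P.Regular)
include hreg

lemma measurable_comp {θ : Vec m} (hθ : θ ∈ P.Θ) (s : S) (k : Fin N) :
    Measurable (P.comp θ s k) :=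
  (((hreg.comp k).continuous_of_mem hθ).comp
    (by fun_prop : Continuous fun a : Vec d => (s, a))).measurable

lemma continuous_f {θ : Vec m} (hθ : θ ∈ P.Θ) (s : S) (k : Fin N) :
    Continuous (P.f θ s k) :=
  ((hreg.f k).continuous_of_mem hθ).comp (by fun_prop : Continuous fun a : Vec d => (s, a))

lemma toReal_comp_smul_ae {F : Type*} [NormedAddCommGroup F] [NormedSpace ℝ F]
    (hA : MeasurableSet A) {θ : Vec m} (hθ : θ ∈ P.Θ) (s : S) (k : Fin N) (q : Vec d → F) :
    (fun a => (ENNReal.ofReal (P.comp θ s k a)).toReal • q a) =ᵐ[volume.restrict A]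
      fun a => P.comp θ s k a • q a := by
  filter_upwards [ae_restrict_mem hA] with a ha
  rw [ENNReal.toReal_ofReal (hP.comp_nonneg θ hθ s k a ha)]

variable {F : Type*} [NormedAddCommGroup F] [NormedSpace ℝ F]

lemma integral_comp_smul (hA : MeasurableSet A) {θ : Vec m} (hθ : θ ∈ P.Θ) (s : S) (k : Fin N)
    {q : Vec d → F} (hq : StronglyMeasurable q) :
    ∫ a in A, P.comp θ s k a • q a = ∫ ε, q (P.f θ s k ε) ∂P.noiseLaw := by
  rw [← integral_map (continuous_f hP hreg hθ s k).measurable.aemeasurable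
      hq.aestronglyMeasurable, hP.map_noise θ hθ s k,
    integral_withDensity_eq_integral_toReal_smul (measurable_comp hP hreg hθ s k).ennreal_ofReal
      (ae_of_all _ fun _ => ENNReal.ofReal_lt_top)]
  exact (integral_congr_ae (toReal_comp_smul_ae hP hreg hA hθ s k q)).symm

lemma integrableOn_comp_smul (hA : MeasurableSet A) {θ : Vec m} (hθ : θ ∈ P.Θ) (s : S) (k : Fin N)
    {q : Vec d → F} (hq : StronglyMeasurable q)
    (hi : Integrable (fun ε => q (P.f θ s k ε)) P.noiseLaw) :
    IntegrableOn (fun a => P.comp θ s k a • q a) A := by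
  have h := (integrable_map_measure (μ := P.noiseLaw) (f := P.f θ s k) (g := q)
    hq.aestronglyMeasurable (continuous_f hP hreg hθ s k).measurable.aemeasurable).2 hi
  rw [hP.map_noise θ hθ s k, integrable_withDensity_iff_integrable_smul'
    (measurable_comp hP hreg hθ s k).ennreal_ofReal
    (ae_of_all _ fun _ => ENNReal.ofReal_lt_top)] at h
  exact h.congr (toReal_comp_smul_ae hP hreg hA hθ s k q)

/-- Integrals against the mixture policy in terms of the reparameterization. -/
lemma integral_mixture_smul (hA : MeasurableSet A) {θ : Vec m} (hθ : θ ∈ P.Θ) (s : S)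
    {q : Vec d → F} (hq : StronglyMeasurable q)
    (hi : ∀ k, Integrable (fun ε => q (P.f θ s k ε)) P.noiseLaw) :
    ∫ a in A, P.mixture θ s a • q a =
      ∑ k, P.weight θ s k • ∫ ε, q (P.f θ s k ε) ∂P.noiseLaw := by
  simp_rw [← fun k => integral_comp_smul hP hreg hA hθ s k hq, ← integral_smul]
  rw [← integral_finsetSum]
  · simp_rw [mixture, Finset.sum_smul, mul_smul]
  · exact fun k _ => (integrableOn_comp_smul hP hreg hA hθ s k hq (hi k)).smul _

lemma integral_mixture (hA : MeasurableSet A) (hE : MeasurableSet P.E) {θ : Vec m} (hθ : θ ∈ P.Θ)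
    (s : S) : ∫ a in A, P.mixture θ s a = 1 := by
  have := hP.isProbabilityMeasure_noiseLaw hE
  have h := integral_mixture_smul hP hreg hA hθ s (q := fun _ => (1 : ℝ))
    stronglyMeasurable_const fun k => integrable_const _
  simpa [hP.sum_weight θ hθ s] using h

/-- Over any `B ∩ E`, both sides integrate to the mass of `f(B ∩ E)`: the left by the pushforward
identity `map_noise`, the right by the change of variables formula for the injective map `f`. -/
lemma ae_noise_eq_det_mul_comp (hE : MeasurableSet P.E) {θ : Vec m} (hθ : θ ∈ P.Θ) (s : S)
    (k : Fin N) : ∀ᵐ ε ∂volume.restrict P.E,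
      P.noise ε = |(fderiv ℝ (P.f θ s k) ε).det| * P.comp θ s k (P.f θ s k ε) := by
  have hfc := continuous_f hP hreg hθ s k
  have hpm : Measurable fun ε => ENNReal.ofReal (P.noise ε) :=
    hreg.contDiff_noise.continuous.measurable.ennreal_ofReal
  have hcm := (measurable_comp hP hreg hθ s k).ennreal_ofReal
  have hdet : Measurable fun ε => ENNReal.ofReal |(fderiv ℝ (P.f θ s k) ε).det| := by
    have h1 : Continuous fun ε => fderiv ℝ (P.f θ s k) ε :=
      (hreg.f k).continuousOn_fderiv_var.comp_continuous (f := fun ε => (θ, s, ε)) (by fun_prop)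
        fun _ => hθ
    exact (ContinuousLinearMap.continuous_det.comp h1).abs.measurable.ennreal_ofReal
  have hinj : Set.InjOn (P.f θ s k) P.E := (hP.invOn θ hθ s k).1.injOn
  have hder : ∀ ε, HasFDerivAt (P.f θ s k) (fderiv ℝ (P.f θ s k) ε) ε :=
    (hreg.f k).hasFDerivAt_var hθ s
  have key : (fun ε => ENNReal.ofReal (P.noise ε)) =ᵐ[volume.restrict P.E] fun ε =>
      ENNReal.ofReal |(fderiv ℝ (P.f θ s k) ε).det| *
        ENNReal.ofReal (P.comp θ s k (P.f θ s k ε)) := by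
    refine ae_eq_of_forall_setLIntegral_eq_of_sigmaFinite hpm
      (hdet.mul (hcm.comp hfc.measurable)) fun B hB _ => ?_
    rw [Measure.restrict_restrict hB]
    have hBE := hB.inter hE
    have hder' : ∀ ε ∈ B ∩ P.E, HasFDerivWithinAt (P.f θ s k) (fderiv ℝ (P.f θ s k) ε) (B ∩ P.E) ε :=
      fun ε _ => (hder ε).hasFDerivWithinAt
    have hinj' := hinj.mono (Set.inter_subset_right (s := B))
    rw [← lintegral_image_eq_lintegral_abs_det_fderiv_mul volume hBE hder' hinj'
      fun a => ENNReal.ofReal (P.comp θ s k a)]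
    have him : MeasurableSet (P.f θ s k '' (B ∩ P.E)) :=
      measurable_image_of_fderivWithin hBE hder' hinj'
    have hsub : P.f θ s k '' (B ∩ P.E) ⊆ A := by
      rintro _ ⟨ε, hε, rfl⟩
      exact hP.mapsTo θ hθ s k hε.2
    have h1 := congrArg (fun μ => μ (P.f θ s k '' (B ∩ P.E))) (hP.map_noise θ hθ s k)
    simp only [Measure.map_apply hfc.measurable him] at h1
    rw [withDensity_apply _ him, Measure.restrict_restrict him,
      Set.inter_eq_left.2 hsub] at h1
    rw [← h1, noiseLaw, withDensity_apply _ (hfc.measurable him),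
      Measure.restrict_restrict (hfc.measurable him)]
    -- Injectivity of `f` on `E`: the part in `E` of the preimage of `f(B ∩ E)` is `B ∩ E` itself.
    congr 2
    ext ε
    constructor
    · exact fun hε => ⟨⟨ε, hε, rfl⟩, hε.2⟩
    · rintro ⟨⟨ε', hε', he⟩, hε⟩
      rwa [← hinj hε'.2 hε he]
  filter_upwards [key, ae_restrict_mem hE] with ε h hε
  have hc := hP.comp_nonneg θ hθ s k _ (hP.mapsTo θ hθ s k hε)
  rw [← ENNReal.ofReal_mul (abs_nonneg _)] at h
  exact (ENNReal.ofReal_eq_ofReal_iff (hP.noise_nonneg ε hε) (by positivity)).1 h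

end IsPolicyOn

/-- The noise value `ε` is in `E`, has positive density, and satisfies the change of variables
formula for all parameters. -/
def GoodNoise (P : ReparamMixture S m N d) (ε : Vec d) : Prop :=
  ε ∈ P.E ∧ 0 < P.noise ε ∧ ∀ θ ∈ P.Θ, ∀ s k,
    P.noise ε = |(fderiv ℝ (P.f θ s k) ε).det| * P.comp θ s k (P.f θ s k ε)

/-- The null set of the change of variables formula depends on `(θ, s, k)`. The union over a
countable dense set of `(θ, s)` is still null, and continuity extends the formula to all parameters.
A single null set is needed for bounds that hold simultaneously for all parameters near `θ`. -/
lemma IsPolicyOn.ae_goodNoise (hP : P.IsPolicyOn A) (hreg : P.Regular) (hE : MeasurableSet P.E) :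
    ∀ᵐ ε ∂P.noiseLaw, P.GoodNoise ε := by
  obtain ⟨D, hDc, hD⟩ := TopologicalSpace.exists_countable_dense (P.Θ × S)
  have h1 : ∀ᵐ ε ∂volume.restrict P.E, ∀ k, ∀ x ∈ D, P.noise ε =
      |(fderiv ℝ (P.f x.1 x.2 k) ε).det| * P.comp x.1 x.2 k (P.f x.1 x.2 k ε) :=
    ae_all_iff.2 fun k => (ae_ball_iff hDc).2 fun x _ =>
      hP.ae_noise_eq_det_mul_comp hreg hE x.1.2 x.2 k
  rw [noiseLaw, ae_withDensity_iff hreg.contDiff_noise.continuous.measurable.ennreal_ofReal]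
  filter_upwards [h1, ae_restrict_mem hE] with ε h hε hne
  refine ⟨hε, ?_, fun θ hθ s k => ?_⟩
  · rwa [ne_eq, ENNReal.ofReal_eq_zero, not_le] at hne
  · have hf : Continuous fun x : P.Θ × S => P.f x.1 x.2 k ε :=
      (hreg.f k).continuousOn.comp_continuous
        (f := fun x : P.Θ × S => ((x.1 : Vec m), x.2, ε)) (by fun_prop) fun x => x.1.2
    have hc : Continuous fun x : P.Θ × S => P.comp x.1 x.2 k (P.f x.1 x.2 k ε) :=
      (hreg.comp k).continuousOn.comp_continuous
        (f := fun x : P.Θ × S => ((x.1 : Vec m), x.2, P.f x.1 x.2 k ε)) (by fun_prop)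
        fun x => x.1.2
    have hd : Continuous fun x : P.Θ × S => |(fderiv ℝ (P.f x.1 x.2 k) ε).det| :=
      (ContinuousLinearMap.continuous_det.comp
        ((hreg.f k).continuousOn_fderiv_var.comp_continuous
          (f := fun x : P.Θ × S => ((x.1 : Vec m), x.2, ε)) (by fun_prop) fun x => x.1.2)).abs
    exact congrFun (Continuous.ext_on hD continuous_const (hd.mul hc) fun x hx => h k x hx)
      (⟨θ, hθ⟩, s)

end ReparamMixture

/-! ### Local bounds and the dominating function `1 + 1/p`. -/

namespace ReparamMixture

variable {S : Type*} [MetricSpace S] [CompactSpace S] [MeasurableSpace S] [BorelSpace S]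
  {m N d : ℕ} {P : ReparamMixture S m N d} {A : Set (Vec d)} {B : S → Vec d → ℝ}

/-- On `U`, the data of the mixture policy, the function `B` and their derivatives are bounded
by `K`. -/
structure LocalBound (P : ReparamMixture S m N d) (A : Set (Vec d)) (B : S → Vec d → ℝ)
    (U : Set (Vec m)) (K : ℝ) : Prop where
  isOpen : IsOpen U
  convex : Convex ℝ U
  subset : U ⊆ P.Θ
  nonneg : 0 ≤ K
  weight : ∀ θ ∈ U, ∀ s k, ‖P.weight θ s k‖ ≤ K
  inv_weight : ∀ θ ∈ U, ∀ s k, ‖(P.weight θ s k)⁻¹‖ ≤ K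
  fderiv_weight : ∀ θ ∈ U, ∀ s k, ‖fderiv ℝ (fun θ' => P.weight θ' s k) θ‖ ≤ K
  mixture : ∀ θ ∈ U, ∀ s, ∀ a ∈ A, ‖P.mixture θ s a‖ ≤ K
  fderiv_mixture_param : ∀ θ ∈ U, ∀ s, ∀ a ∈ A, ‖fderiv ℝ (fun θ' => P.mixture θ' s a) θ‖ ≤ K
  fderiv_mixture_var : ∀ θ ∈ U, ∀ s, ∀ a ∈ A, ‖fderiv ℝ (P.mixture θ s) a‖ ≤ K
  fderiv_f : ∀ θ ∈ U, ∀ s k, ∀ ε ∈ P.E, ‖fderiv ℝ (fun θ' => P.f θ' s k ε) θ‖ ≤ K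
  det : ∀ θ ∈ U, ∀ s k, ∀ ε ∈ P.E, |(fderiv ℝ (P.f θ s k) ε).det| ≤ K
  base : ∀ s, ∀ a ∈ A, ‖B s a‖ ≤ K
  fderiv_base : ∀ s, ∀ a ∈ A, ‖fderiv ℝ (B s) a‖ ≤ K

/-- The regularized action-value function `B(s, a) - α log π_θ(a | s)`. -/
noncomputable def reg (P : ReparamMixture S m N d) (B : S → Vec d → ℝ) (α : ℝ) (θ : Vec m) (s : S)
    (a : Vec d) : ℝ :=
  B s a - α * Real.log (P.mixture θ s a)

/-- The derivative of `reg` in the action. -/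
noncomputable def regDeriv (P : ReparamMixture S m N d) (B : S → Vec d → ℝ) (α : ℝ) (θ : Vec m)
    (s : S) (a : Vec d) : Vec d →L[ℝ] ℝ :=
  fderiv ℝ (B s) a - (α * (P.mixture θ s a)⁻¹) • fderiv ℝ (P.mixture θ s) a

/-- The score `∇_θ log π_θ(a | s)`. -/
noncomputable def score (P : ReparamMixture S m N d) (θ : Vec m) (s : S) (a : Vec d) :
    Vec m →L[ℝ] ℝ :=
  (P.mixture θ s a)⁻¹ • fderiv ℝ (fun θ' => P.mixture θ' s a) θ

/-- The derivative of `θ ↦ reg θ s (f θ s k ε)`. -/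
noncomputable def pathDeriv (P : ReparamMixture S m N d) (B : S → Vec d → ℝ) (α : ℝ) (θ : Vec m)
    (s : S) (k : Fin N) (ε : Vec d) : Vec m →L[ℝ] ℝ :=
  (P.regDeriv B α θ s (P.f θ s k ε)).comp (fderiv ℝ (fun θ' => P.f θ' s k ε) θ)

variable (hP : P.IsPolicyOn A) (hreg : P.Regular) (hB : ContC1 P.Θ fun _ : Vec m => B) (α : ℝ)

section
include hP hreg hB

/-- Each quantity is continuous, hence bounded over a closed ball times `S` and `A` or `E`; `K` is
the sum of the ten bounds. The open ball is convex, as mean value estimates require. -/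
lemma exists_localBound (hA : IsCompact A) (hE : IsCompact P.E) {θ : Vec m} (hθ : θ ∈ P.Θ) :
    ∃ U K, θ ∈ U ∧ LocalBound P A B U K := by
  obtain ⟨ρ, hρ, hsub⟩ := Metric.nhds_basis_closedBall.mem_iff.1 (hP.isOpen_Θ.mem_nhds hθ)
  set T := Metric.closedBall θ ρ with hT
  have hTc : IsCompact T := isCompact_closedBall θ ρ
  have b3 : ∀ {V : Type} [NormedAddCommGroup V] (Z : Set (Vec d)), IsCompact Z →
      ∀ h : Vec m × S × Vec d → V, ContinuousOn h {x | x.1 ∈ P.Θ} →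
      ∃ C, 0 ≤ C ∧ ∀ θ' ∈ T, ∀ s, ∀ v ∈ Z, ‖h (θ', s, v)‖ ≤ C := by
    intro V _ Z hZ h hh
    obtain ⟨C, hC⟩ := (hTc.prod (isCompact_univ.prod hZ)).exists_bound_of_continuousOn
      (hh.mono fun x hx => hsub hx.1)
    exact ⟨max C 0, le_max_right _ _, fun θ' hθ' s v hv =>
      (hC (θ', s, v) ⟨hθ', trivial, hv⟩).trans (le_max_left _ _)⟩
  have b2 : ∀ {V : Type} [NormedAddCommGroup V] (h : Fin N → Vec m × S → V),
      (∀ k, ContinuousOn (h k) {x | x.1 ∈ P.Θ}) →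
      ∃ C, 0 ≤ C ∧ ∀ θ' ∈ T, ∀ s k, ‖h k (θ', s)‖ ≤ C := by
    intro V _ h hh
    choose C hC using fun k => (hTc.prod isCompact_univ).exists_bound_of_continuousOn
      ((hh k).mono fun x hx => hsub hx.1)
    refine ⟨∑ k, |C k|, Finset.sum_nonneg fun _ _ => abs_nonneg _, fun θ' hθ' s k => ?_⟩
    exact (hC k (θ', s) ⟨hθ', trivial⟩).trans ((le_abs_self _).trans
      (Finset.single_le_sum (f := fun k => |C k|) (fun _ _ => abs_nonneg _) (Finset.mem_univ k)))
  have b3k : ∀ {V : Type} [NormedAddCommGroup V] (Z : Set (Vec d)), IsCompact Z →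
      ∀ h : Fin N → Vec m × S × Vec d → V, (∀ k, ContinuousOn (h k) {x | x.1 ∈ P.Θ}) →
      ∃ C, 0 ≤ C ∧ ∀ θ' ∈ T, ∀ s k, ∀ v ∈ Z, ‖h k (θ', s, v)‖ ≤ C := by
    intro V _ Z hZ h hh
    choose C hC0 hC using fun k => b3 Z hZ (h k) (hh k)
    refine ⟨∑ k, C k, Finset.sum_nonneg fun k _ => hC0 k, fun θ' hθ' s k v hv => ?_⟩
    exact (hC k θ' hθ' s v hv).trans
      (Finset.single_le_sum (f := C) (fun k _ => hC0 k) (Finset.mem_univ k))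
  have hmix := hreg.contC1_mixture
  obtain ⟨C1, h10, h1⟩ := b2 (fun k x => P.weight x.1 x.2 k) hreg.continuousOn_weight
  obtain ⟨C2, h20, h2⟩ := b2 (fun k x => (P.weight x.1 x.2 k)⁻¹) fun k =>
    (hreg.continuousOn_weight k).inv₀ fun x hx => (hP.weight_pos x.1 hx x.2 k).ne'
  obtain ⟨C3, h30, h3⟩ := b2 _ hreg.continuousOn_fderiv_weight
  obtain ⟨C4, h40, h4⟩ := b3 A hA _ hmix.continuousOn
  obtain ⟨C5, h50, h5⟩ := b3 A hA _ hmix.continuousOn_fderiv_param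
  obtain ⟨C6, h60, h6⟩ := b3 A hA _ hmix.continuousOn_fderiv_var
  obtain ⟨C7, h70, h7⟩ := b3k P.E hE _ fun k => (hreg.f k).continuousOn_fderiv_param
  obtain ⟨C8, h80, h8⟩ := b3k P.E hE _ fun k =>
    ContinuousLinearMap.continuous_det.comp_continuousOn (hreg.f k).continuousOn_fderiv_var
  obtain ⟨C9, h90, h9⟩ := b3 A hA _ hB.continuousOn
  obtain ⟨C10, h100, h11⟩ := b3 A hA _ hB.continuousOn_fderiv_var
  refine ⟨Metric.ball θ ρ, C1 + C2 + C3 + C4 + C5 + C6 + C7 + C8 + C9 + C10,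
    Metric.mem_ball_self hρ, Metric.isOpen_ball, convex_ball _ _,
    Metric.ball_subset_closedBall.trans hsub, by positivity, ?_, ?_, ?_, ?_, ?_, ?_, ?_, ?_, ?_, ?_⟩
  · exact fun θ' hθ' s k => (h1 θ' (Metric.ball_subset_closedBall hθ') s k).trans (by linarith)
  · exact fun θ' hθ' s k => (h2 θ' (Metric.ball_subset_closedBall hθ') s k).trans (by linarith)
  · exact fun θ' hθ' s k => (h3 θ' (Metric.ball_subset_closedBall hθ') s k).trans (by linarith)
  · exact fun θ' hθ' s a ha =>
      (h4 θ' (Metric.ball_subset_closedBall hθ') s a ha).trans (by linarith)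
  · exact fun θ' hθ' s a ha =>
      (h5 θ' (Metric.ball_subset_closedBall hθ') s a ha).trans (by linarith)
  · exact fun θ' hθ' s a ha =>
      (h6 θ' (Metric.ball_subset_closedBall hθ') s a ha).trans (by linarith)
  · exact fun θ' hθ' s k ε hε =>
      (h7 θ' (Metric.ball_subset_closedBall hθ') s k ε hε).trans (by linarith)
  · exact fun θ' hθ' s k ε hε =>
      (h8 θ' (Metric.ball_subset_closedBall hθ') s k ε hε).trans (by linarith)
  · exact fun s a ha => (h9 θ (Metric.mem_closedBall_self hρ.le) s a ha).trans (by linarith)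
  · exact fun s a ha => (h11 θ (Metric.mem_closedBall_self hρ.le) s a ha).trans (by linarith)

end

/-- A function of the noise that dominates, up to a constant, all functions that occur. -/
noncomputable def noiseBound (P : ReparamMixture S m N d) (ε : Vec d) : ℝ := 1 + (P.noise ε)⁻¹

lemma GoodNoise.noiseBound_nonneg {ε : Vec d} (hε : P.GoodNoise ε) : 0 ≤ P.noiseBound ε :=
  add_nonneg zero_le_one (inv_nonneg.2 hε.2.1.le)

/-- Multiplied by the density, `1 + 1/p` becomes `p + 1` where `p > 0` and `0` elsewhere, which is
bounded on the compact set `E`. -/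
lemma Regular.integrable_noiseBound (hreg : P.Regular) (hE : IsCompact P.E) :
    Integrable P.noiseBound P.noiseLaw := by
  have hc := hreg.contDiff_noise.continuous
  have hm : Measurable P.noiseBound := hc.measurable.inv.const_add 1
  rw [noiseLaw, integrable_withDensity_iff_integrable_smul' hc.measurable.ennreal_ofReal
    (ae_of_all _ fun _ => ENNReal.ofReal_lt_top)]
  have : IsFiniteMeasure (volume.restrict P.E) :=
    ⟨by rw [Measure.restrict_apply_univ]; exact hE.measure_lt_top⟩
  obtain ⟨C, hC⟩ := hE.exists_bound_of_continuousOn hc.continuousOn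
  refine Integrable.of_bound
    (hc.measurable.ennreal_ofReal.ennreal_toReal.smul hm).aestronglyMeasurable (C + 1) ?_
  filter_upwards [ae_restrict_mem hE.measurableSet] with ε hε
  have h1 := hC ε hε
  rcases le_or_gt (P.noise ε) 0 with h | h
  · rw [ENNReal.ofReal_eq_zero.2 h]
    have := (norm_nonneg _).trans h1
    simp; linarith
  · rw [ENNReal.toReal_ofReal h.le, noiseBound, smul_eq_mul, mul_add, mul_inv_cancel₀ h.ne',
      mul_one, Real.norm_of_nonneg (by positivity)]
    rw [Real.norm_of_nonneg h.le] at h1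
    linarith

section Bounds

variable {U : Set (Vec m)} {K : ℝ} (hU : LocalBound P A B U K)
include hU hP

/-- The mixture is at least its `k`-th term. One factor `K` bounds the inverse weight, the other
bounds `|det Df| = p / π^c`. -/
lemma LocalBound.mixture_pos {θ : Vec m} (hθ : θ ∈ U) (s : S) (k : Fin N) {ε : Vec d}
    (hε : P.GoodNoise ε) :
    0 < P.mixture θ s (P.f θ s k ε) ∧
      (P.mixture θ s (P.f θ s k ε))⁻¹ ≤ K * K * (P.noise ε)⁻¹ := by
  have hθ' := hU.subset hθ
  obtain ⟨hεE, hp, heq⟩ := hε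
  have ha := hP.mapsTo θ hθ' s k hεE
  have hc0 := hP.comp_nonneg θ hθ' s k _ ha
  have he := heq θ hθ' s k
  have hw := hP.weight_pos θ hθ' s k
  have hc : 0 < P.comp θ s k (P.f θ s k ε) := by
    refine hc0.lt_of_ne fun h => ?_
    rw [← h, mul_zero] at he
    exact hp.ne' he
  have hle : P.weight θ s k * P.comp θ s k (P.f θ s k ε) ≤ P.mixture θ s (P.f θ s k ε) :=
    Finset.single_le_sum (f := fun k' => P.weight θ s k' * P.comp θ s k' (P.f θ s k ε))
      (fun k' _ => mul_nonneg (hP.weight_pos θ hθ' s k').le (hP.comp_nonneg θ hθ' s k' _ ha))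
      (Finset.mem_univ k)
  have hwc := mul_pos hw hc
  refine ⟨hwc.trans_le hle, ?_⟩
  have hci : (P.comp θ s k (P.f θ s k ε))⁻¹ ≤ K * (P.noise ε)⁻¹ := by
    rw [← div_eq_mul_inv, le_div_iff₀ hp, he, mul_comm, mul_assoc, mul_inv_cancel₀ hc.ne', mul_one]
    exact hU.det θ hθ s k ε hεE
  have hwi : (P.weight θ s k)⁻¹ ≤ K := (le_abs_self _).trans (hU.inv_weight θ hθ s k)
  calc (P.mixture θ s (P.f θ s k ε))⁻¹ ≤ (P.weight θ s k * P.comp θ s k (P.f θ s k ε))⁻¹ :=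
        inv_anti₀ hwc hle
    _ = (P.weight θ s k)⁻¹ * (P.comp θ s k (P.f θ s k ε))⁻¹ := mul_inv _ _
    _ ≤ K * (K * (P.noise ε)⁻¹) := mul_le_mul hwi hci (inv_nonneg.2 hc.le) hU.nonneg
    _ = K * K * (P.noise ε)⁻¹ := (mul_assoc _ _ _).symm

lemma LocalBound.norm_reg_le {θ : Vec m} (hθ : θ ∈ U) (s : S) (k : Fin N) {ε : Vec d}
    (hε : P.GoodNoise ε) :
    ‖P.reg B α θ s (P.f θ s k ε)‖ ≤ (K + |α| * (K + K * K)) * P.noiseBound ε := by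
  obtain ⟨hpos, hinv⟩ := hU.mixture_pos hP hθ s k hε
  have ha := hP.mapsTo θ (hU.subset hθ) s k hε.1
  have hK := hU.nonneg
  have hp : 0 ≤ (P.noise ε)⁻¹ := inv_nonneg.2 hε.2.1.le
  -- From `1 - 1/x ≤ log x ≤ x - 1`: large densities are controlled by `K`, small ones by `K² / p`.
  have hlog : |Real.log (P.mixture θ s (P.f θ s k ε))| ≤ (K + K * K) * P.noiseBound ε := by
    have h1 := Real.log_le_sub_one_of_pos hpos
    have h2 := Real.one_sub_inv_le_log_of_pos hpos
    have h3 := (le_abs_self _).trans (hU.mixture θ hθ s _ ha)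
    unfold noiseBound
    rw [abs_le]
    constructor <;> nlinarith [mul_nonneg hK hp, mul_nonneg hK hK, mul_nonneg (mul_nonneg hK hK) hp]
  have hb1 : 1 ≤ P.noiseBound ε := by unfold noiseBound; linarith
  calc ‖P.reg B α θ s (P.f θ s k ε)‖ ≤ ‖B s (P.f θ s k ε)‖ +
        ‖α * Real.log (P.mixture θ s (P.f θ s k ε))‖ := norm_sub_le _ _
    _ ≤ K * P.noiseBound ε + |α| * ((K + K * K) * P.noiseBound ε) := by
        refine add_le_add ((hU.base s _ ha).trans (le_mul_of_one_le_right hK hb1)) ?_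
        rw [norm_mul]
        exact mul_le_mul_of_nonneg_left hlog (abs_nonneg _)
    _ = _ := by ring

lemma LocalBound.norm_score_le {θ : Vec m} (hθ : θ ∈ U) (s : S) (k : Fin N) {ε : Vec d}
    (hε : P.GoodNoise ε) :
    ‖P.score θ s (P.f θ s k ε)‖ ≤ K * K * K * P.noiseBound ε := by
  obtain ⟨hpos, hinv⟩ := hU.mixture_pos hP hθ s k hε
  have ha := hP.mapsTo θ (hU.subset hθ) s k hε.1
  have hK := hU.nonneg
  have hp : 0 ≤ (P.noise ε)⁻¹ := inv_nonneg.2 hε.2.1.le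
  rw [score, norm_smul, Real.norm_of_nonneg (inv_nonneg.2 hpos.le)]
  calc _ ≤ K * K * (P.noise ε)⁻¹ * K :=
        mul_le_mul hinv (hU.fderiv_mixture_param θ hθ s _ ha) (norm_nonneg _) (by positivity)
    _ ≤ _ := by
        unfold noiseBound
        nlinarith [mul_nonneg hK (mul_nonneg hK hK)]

lemma LocalBound.norm_pathDeriv_le {θ : Vec m} (hθ : θ ∈ U) (s : S) (k : Fin N) {ε : Vec d}
    (hε : P.GoodNoise ε) :
    ‖P.pathDeriv B α θ s k ε‖ ≤ (K + |α| * (K * K * K)) * K * P.noiseBound ε := by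
  obtain ⟨hpos, hinv⟩ := hU.mixture_pos hP hθ s k hε
  have ha := hP.mapsTo θ (hU.subset hθ) s k hε.1
  have hK := hU.nonneg
  have hp : 0 ≤ (P.noise ε)⁻¹ := inv_nonneg.2 hε.2.1.le
  have h1 : ‖P.regDeriv B α θ s (P.f θ s k ε)‖ ≤ (K + |α| * (K * K * K)) * P.noiseBound ε := by
    have h2 : ‖(α * (P.mixture θ s (P.f θ s k ε))⁻¹) • fderiv ℝ (P.mixture θ s) (P.f θ s k ε)‖ ≤
        |α| * (K * K * (P.noise ε)⁻¹) * K := by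
      rw [norm_smul, norm_mul, Real.norm_of_nonneg (inv_nonneg.2 hpos.le)]
      exact mul_le_mul (mul_le_mul_of_nonneg_left hinv (norm_nonneg _))
        (hU.fderiv_mixture_var θ hθ s _ ha) (norm_nonneg _) (by positivity)
    refine (norm_sub_le _ _).trans ((add_le_add (hU.fderiv_base s _ ha) h2).trans ?_)
    unfold noiseBound
    have e1 := mul_nonneg hK hp
    have e2 := mul_nonneg (abs_nonneg α) (mul_nonneg hK (mul_nonneg hK hK))
    nlinarith
  calc _ ≤ ‖P.regDeriv B α θ s (P.f θ s k ε)‖ * ‖fderiv ℝ (fun θ' => P.f θ' s k ε) θ‖ :=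
        ContinuousLinearMap.opNorm_comp_le _ _
    _ ≤ (K + |α| * (K * K * K)) * P.noiseBound ε * K :=
        mul_le_mul h1 (hU.fderiv_f θ hθ s k ε hε.1) (norm_nonneg _)
          (mul_nonneg (by positivity) hε.noiseBound_nonneg)
    _ = _ := by ring

include hreg hB

/-- `θ` enters through the moving action, which gives `pathDeriv`, and through the density inside
the logarithm, which gives `-α` times the score. `B` is frozen and contributes only to the former.
-/
lemma LocalBound.hasFDerivAt_reg_path {θ : Vec m} (hθ : θ ∈ U) (s : S) (k : Fin N) {ε : Vec d}
    (hε : P.GoodNoise ε) :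
    HasFDerivAt (fun θ' => P.reg B α θ' s (P.f θ' s k ε))
      (P.pathDeriv B α θ s k ε - α • P.score θ s (P.f θ s k ε)) θ := by
  have hθ' := hU.subset hθ
  have hf := (hreg.f k).hasFDerivAt_param hθ' s ε
  have h1 := hB.hasFDerivAt_comp hP.isOpen_Θ hθ' s hf
  have h2 := (hreg.contC1_mixture.hasFDerivAt_comp hP.isOpen_Θ hθ' s hf).log
    (hU.mixture_pos hP hθ s k hε).1.ne'
  refine (h1.sub (h2.const_mul α)).congr_fderiv (ContinuousLinearMap.ext fun v => ?_)
  simp [pathDeriv, regDeriv, score]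
  ring

end Bounds

end ReparamMixture

/-! ### Differentiation of the lookahead value with the action value frozen. -/

namespace ReparamMixture

variable {S : Type*} [MetricSpace S] [CompactSpace S] [MeasurableSpace S] [BorelSpace S]
  {m N d : ℕ} {P : ReparamMixture S m N d} {A : Set (Vec d)} {B : S → Vec d → ℝ}
  (hP : P.IsPolicyOn A) (hreg : P.Regular) (hB : ContC1 P.Θ fun _ : Vec m => B) (α : ℝ)

section Measurability

include hreg

lemma Regular.measurable_mixture {θ : Vec m} (hθ : θ ∈ P.Θ) :
    Measurable fun x : S × Vec d => P.mixture θ x.1 x.2 :=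
  (hreg.contC1_mixture.continuous_of_mem hθ).measurable

lemma Regular.stronglyMeasurable_score {θ : Vec m} (hθ : θ ∈ P.Θ) :
    StronglyMeasurable fun x : S × Vec d => P.score θ x.1 x.2 :=
  (hreg.measurable_mixture hθ).inv.stronglyMeasurable.smul
    (hreg.contC1_mixture.continuousOn_fderiv_param.comp_continuous
      (f := fun x : S × Vec d => (θ, x.1, x.2)) (by fun_prop) fun _ => hθ).stronglyMeasurable

include hB

lemma Regular.stronglyMeasurable_reg {θ : Vec m} (hθ : θ ∈ P.Θ) :
    StronglyMeasurable fun x : S × Vec d => P.reg B α θ x.1 x.2 :=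
  ((hB.continuous_of_mem hθ).measurable.sub
    ((hreg.measurable_mixture hθ).log.const_mul α)).stronglyMeasurable

lemma Regular.stronglyMeasurable_regDeriv {θ : Vec m} (hθ : θ ∈ P.Θ) :
    StronglyMeasurable fun x : S × Vec d => P.regDeriv B α θ x.1 x.2 := by
  have h1 := (hB.continuousOn_fderiv_var.comp_continuous
    (f := fun x : S × Vec d => (θ, x.1, x.2)) (by fun_prop) fun _ => hθ).stronglyMeasurable
  have h2 := (hreg.contC1_mixture.continuousOn_fderiv_var.comp_continuous
    (f := fun x : S × Vec d => (θ, x.1, x.2)) (by fun_prop) fun _ => hθ).stronglyMeasurable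
  exact h1.sub (((hreg.measurable_mixture hθ).inv.const_mul α).stronglyMeasurable.smul h2)

lemma Regular.stronglyMeasurable_pathDeriv {θ : Vec m} (hθ : θ ∈ P.Θ) (k : Fin N) :
    StronglyMeasurable fun x : S × Vec d => P.pathDeriv B α θ x.1 k x.2 := by
  have h1 : StronglyMeasurable fun x : S × Vec d => P.regDeriv B α θ x.1 (P.f θ x.1 k x.2) :=
    (hreg.stronglyMeasurable_regDeriv hB α hθ).comp_measurable
      (measurable_fst.prodMk (hreg.measurable_f hθ k))
  have h2 : StronglyMeasurable fun x : S × Vec d => fderiv ℝ (fun θ' => P.f θ' x.1 k x.2) θ :=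
    ((hreg.f k).continuousOn_fderiv_param.comp_continuous
      (f := fun x : S × Vec d => (θ, x.1, x.2)) (by fun_prop) fun _ => hθ).stronglyMeasurable
  exact isBoundedBilinearMap_comp.continuous.comp_stronglyMeasurable (h1.prodMk h2)

end Measurability

section Derivative

variable {U : Set (Vec m)} {K : ℝ} (hU : LocalBound P A B U K) (hA : IsCompact A)
  (hE : IsCompact P.E)

include hP hreg hU hE

lemma LocalBound.integrable_score_path {θ : Vec m} (hθ : θ ∈ U) (s : S) (k : Fin N) :
    Integrable (fun ε => P.score θ s (P.f θ s k ε)) P.noiseLaw := by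
  have hθ' := hU.subset hθ
  refine ((hreg.integrable_noiseBound hE).const_mul (K * K * K)).mono'
    ((hreg.stronglyMeasurable_score hθ').comp_measurable (measurable_const.prodMk
      (hP.continuous_f hreg hθ' s k).measurable)).aestronglyMeasurable ?_
  filter_upwards [hP.ae_goodNoise hreg hE.measurableSet] with ε hε
    using hU.norm_score_le hP hθ s k hε

include hA in
/-- The expected score vanishes. -/
lemma LocalBound.sum_integral_score {θ : Vec m} (hθ : θ ∈ U) (s : S) :
    ∑ k, P.weight θ s k • ∫ ε, P.score θ s (P.f θ s k ε) ∂P.noiseLaw = 0 := by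
  have hθ' := hU.subset hθ
  have hmix := hreg.contC1_mixture
  have hfin : IsFiniteMeasure (volume.restrict A) :=
    ⟨by rw [Measure.restrict_apply_univ]; exact hA.measure_lt_top⟩
  have hcont : ∀ θ' ∈ P.Θ, Continuous (P.mixture θ' s) := fun θ' h =>
    (hmix.continuous_of_mem h).comp (by fun_prop : Continuous fun a : Vec d => (s, a))
  rw [← hP.integral_mixture_smul hreg hA.measurableSet hθ' s (q := P.score θ s)
    ((hreg.stronglyMeasurable_score hθ').comp_measurable measurable_prodMk_left)
    fun k => hU.integrable_score_path hP hreg hE hθ s k]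
  have h1 : HasFDerivAt (fun θ' => ∫ a in A, P.mixture θ' s a)
      (∫ a in A, fderiv ℝ (fun θ' => P.mixture θ' s a) θ) θ := by
    refine hasFDerivAt_integral_of_dominated_of_fderiv_le (s := U) (bound := fun _ => K)
      (F' := fun θ' a => fderiv ℝ (fun θ' => P.mixture θ' s a) θ')
      (hU.isOpen.mem_nhds hθ) ?_ ?_ ?_ ?_ (integrable_const _) ?_
    · filter_upwards [hU.isOpen.mem_nhds hθ] with θ' h
      exact (hcont θ' (hU.subset h)).aestronglyMeasurable
    · exact (hcont θ hθ').continuousOn.integrableOn_compact hA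
    · exact (hmix.continuousOn_fderiv_param.comp_continuous
        (f := fun a : Vec d => (θ, s, a)) (by fun_prop) fun _ => hθ').aestronglyMeasurable
    · filter_upwards [ae_restrict_mem hA.measurableSet] with a ha θ' h
        using hU.fderiv_mixture_param θ' h s a ha
    · exact ae_of_all _ fun a θ' h => hmix.hasFDerivAt_param (hU.subset h) s a
  have h2 : HasFDerivAt (fun θ' => ∫ a in A, P.mixture θ' s a) (0 : Vec m →L[ℝ] ℝ) θ := by
    refine (hasFDerivAt_const (1 : ℝ) θ).congr_of_eventuallyEq ?_
    filter_upwards [hU.isOpen.mem_nhds hθ] with θ' h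
    exact hP.integral_mixture hreg hA.measurableSet hE.measurableSet (hU.subset h) s
  rw [← h1.unique h2]
  refine setIntegral_congr_fun hA.measurableSet fun a ha => ?_
  simp only [score]
  rcases eq_or_ne (P.mixture θ s a) 0 with h0 | h0
  -- Where the density vanishes, the score is `0` because `0⁻¹ = 0`, and the true derivative is `0`
  -- because a nonnegative function attains a minimum there.
  · have hmin : IsLocalMin (fun θ' => P.mixture θ' s a) θ := by
      filter_upwards [hU.isOpen.mem_nhds hθ] with θ' h
      rw [h0]
      exact hP.mixture_nonneg (hU.subset h) s ha
    rw [hmin.fderiv_eq_zero, smul_zero, smul_zero]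
  · rw [smul_smul, mul_inv_cancel₀ h0, one_smul]

include hB

lemma LocalBound.integrable_reg_path {θ : Vec m} (hθ : θ ∈ U) (s : S) (k : Fin N) :
    Integrable (fun ε => P.reg B α θ s (P.f θ s k ε)) P.noiseLaw := by
  have hθ' := hU.subset hθ
  refine ((hreg.integrable_noiseBound hE).const_mul
    (K + |α| * (K + K * K))).mono'
    ((hreg.stronglyMeasurable_reg hB α hθ').comp_measurable (measurable_const.prodMk
      (hP.continuous_f hreg hθ' s k).measurable)).aestronglyMeasurable ?_
  filter_upwards [hP.ae_goodNoise hreg hE.measurableSet] with ε hε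
    using hU.norm_reg_le hP α hθ s k hε

lemma LocalBound.integrable_pathDeriv {θ : Vec m} (hθ : θ ∈ U) (s : S) (k : Fin N) :
    Integrable (fun ε => P.pathDeriv B α θ s k ε) P.noiseLaw := by
  have hθ' := hU.subset hθ
  refine ((hreg.integrable_noiseBound hE).const_mul
    ((K + |α| * (K * K * K)) * K)).mono'
    ((hreg.stronglyMeasurable_pathDeriv hB α hθ' k).comp_measurable
      measurable_prodMk_left).aestronglyMeasurable ?_
  filter_upwards [hP.ae_goodNoise hreg hE.measurableSet] with ε hε
    using hU.norm_pathDeriv_le hP α hθ s k hε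

/-- Differentiation under the expectation with respect to the noise. -/
lemma LocalBound.hasFDerivAt_integral_reg_path {θ : Vec m} (hθ : θ ∈ U) (s : S) (k : Fin N) :
    HasFDerivAt (fun θ' => ∫ ε, P.reg B α θ' s (P.f θ' s k ε) ∂P.noiseLaw)
      (∫ ε, P.pathDeriv B α θ s k ε ∂P.noiseLaw -
        α • ∫ ε, P.score θ s (P.f θ s k ε) ∂P.noiseLaw) θ := by
  rw [← integral_smul, ← integral_sub (g := fun ε => α • P.score θ s (P.f θ s k ε))
    (hU.integrable_pathDeriv hP hreg hB α hE hθ s k)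
    ((hU.integrable_score_path hP hreg hE hθ s k).smul α)]
  refine hasFDerivAt_integral_of_dominated_of_fderiv_le (s := U)
    (F' := fun θ ε => P.pathDeriv B α θ s k ε - α • P.score θ s (P.f θ s k ε))
    (bound := fun ε => (K + |α| * (K * K * K)) * K * P.noiseBound ε +
      |α| * (K * K * K * P.noiseBound ε))
    (hU.isOpen.mem_nhds hθ) ?_ (hU.integrable_reg_path hP hreg hB α hE hθ s k) ?_ ?_ ?_ ?_
  · filter_upwards [hU.isOpen.mem_nhds hθ] with θ' h
      using (hU.integrable_reg_path hP hreg hB α hE h s k).aestronglyMeasurable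
  · exact ((hU.integrable_pathDeriv hP hreg hB α hE hθ s k).sub
      ((hU.integrable_score_path hP hreg hE hθ s k).smul α)).aestronglyMeasurable
  · filter_upwards [hP.ae_goodNoise hreg hE.measurableSet] with ε hε θ' h
    refine (norm_sub_le _ _).trans (add_le_add (hU.norm_pathDeriv_le hP α h s k hε) ?_)
    rw [norm_smul]
    exact mul_le_mul_of_nonneg_left (hU.norm_score_le hP h s k hε) (norm_nonneg _)
  · have := hreg.integrable_noiseBound hE
    exact (this.const_mul _).add ((this.const_mul _).const_mul _)
  · filter_upwards [hP.ae_goodNoise hreg hE.measurableSet] with ε hε θ' h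
      using hU.hasFDerivAt_reg_path hP hreg hB α h s k hε

/-- The integrand of the policy gradient, as a linear functional. -/
noncomputable def gradForm (P : ReparamMixture S m N d) (B : S → Vec d → ℝ) (α : ℝ) (θ : Vec m)
    (x : S × Fin N × Vec d) : Vec m →L[ℝ] ℝ :=
  (P.reg B α θ x.1 (P.f θ x.1 x.2.1 x.2.2) * (P.weight θ x.1 x.2.1)⁻¹) •
    fderiv ℝ (fun θ' => P.weight θ' x.1 x.2.1) θ + P.pathDeriv B α θ x.1 x.2.1 x.2.2

lemma LocalBound.norm_gradForm_le {θ : Vec m} (hθ : θ ∈ U) (s : S) (k : Fin N) {ε : Vec d}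
    (hε : P.GoodNoise ε) :
    ‖P.gradForm B α θ (s, k, ε)‖ ≤ ((K + |α| * (K + K * K)) * (K * K) +
      (K + |α| * (K * K * K)) * K) * P.noiseBound ε := by
  have hK := hU.nonneg
  have hb := hε.noiseBound_nonneg
  have h1 : ‖(P.reg B α θ s (P.f θ s k ε) * (P.weight θ s k)⁻¹) •
      fderiv ℝ (fun θ' => P.weight θ' s k) θ‖ ≤
      (K + |α| * (K + K * K)) * P.noiseBound ε * K * K := by
    rw [norm_smul, norm_mul]
    exact mul_le_mul (mul_le_mul (hU.norm_reg_le hP α hθ s k hε) (hU.inv_weight θ hθ s k)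
      (norm_nonneg _) (by positivity)) (hU.fderiv_weight θ hθ s k) (norm_nonneg _) (by positivity)
  refine (norm_add_le _ _).trans ((add_le_add h1 (hU.norm_pathDeriv_le hP α hθ s k hε)).trans_eq ?_)
  ring

include hA in
/-- The derivative of the expected regularized action value, with the action value fixed. -/
lemma LocalBound.hasFDerivAt_sum {θ : Vec m} (hθ : θ ∈ U) (s : S) :
    HasFDerivAt (fun θ' => ∑ k, P.weight θ' s k *
        ∫ ε, P.reg B α θ' s (P.f θ' s k ε) ∂P.noiseLaw)
      (∑ k, P.weight θ s k • ∫ ε, P.gradForm B α θ (s, k, ε) ∂P.noiseLaw) θ := by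
  have hθ' := hU.subset hθ
  have h := HasFDerivAt.fun_sum (u := Finset.univ) fun k _ =>
    (hreg.hasFDerivAt_weight hθ' s k).mul
      (hU.hasFDerivAt_integral_reg_path hP hreg hB α hE hθ s k)
  refine h.congr_fderiv ?_
  have h0 := hU.sum_integral_score hP hreg hA hE hθ s
  have hk : ∀ k, P.weight θ s k • ∫ ε, P.gradForm B α θ (s, k, ε) ∂P.noiseLaw =
      P.weight θ s k • ∫ ε, P.pathDeriv B α θ s k ε ∂P.noiseLaw +
      (∫ ε, P.reg B α θ s (P.f θ s k ε) ∂P.noiseLaw) •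
        fderiv ℝ (fun θ' => P.weight θ' s k) θ := by
    intro k
    have hr := hU.integrable_reg_path hP hreg hB α hE hθ s k
    have e : ∫ ε, P.gradForm B α θ (s, k, ε) ∂P.noiseLaw = _ :=
      integral_add (f := fun ε => (P.reg B α θ s (P.f θ s k ε) * (P.weight θ s k)⁻¹) •
          fderiv ℝ (fun θ' => P.weight θ' s k) θ) ((hr.mul_const _).smul_const _)
        (hU.integrable_pathDeriv hP hreg hB α hE hθ s k)
    rw [e, integral_smul_const, integral_mul_const, smul_add, add_comm, smul_smul]
    congr 2
    rw [mul_comm, mul_assoc, inv_mul_cancel₀ (hP.weight_pos θ hθ' s k).ne', mul_one]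
  -- The remaining score terms add up to `α` times the expected score, which is zero by `h0`.
  simp_rw [hk, smul_sub, sub_add_eq_add_sub, smul_comm (P.weight θ s _) α]
  rw [Finset.sum_sub_distrib, ← Finset.smul_sum, h0, smul_zero, sub_zero]

end Derivative

end ReparamMixture

/-- Integrals over a compact space of a continuous kernel against a bounded function are
continuous. -/
lemma BddMeas.continuous_integral {X S G H F : Type*} [TopologicalSpace X]
    [FirstCountableTopology X] [LocallyCompactSpace X] [MetricSpace S] [CompactSpace S]
    [MeasurableSpace S] [BorelSpace S] [NormedAddCommGroup G] [NormedSpace ℝ G]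
    [NormedAddCommGroup H] [NormedSpace ℝ H] [NormedAddCommGroup F] [NormedSpace ℝ F]
    {ν : Measure S} [IsFiniteMeasure ν] {V : S → H} (hV : BddMeas V) (B : G →L[ℝ] H →L[ℝ] F)
    {φ : X → S → G} (hφ : Continuous (Function.uncurry φ)) :
    Continuous fun x => ∫ s, B (φ x s) (V s) ∂ν := by
  refine continuous_iff_continuousAt.2 fun x₀ => ?_
  obtain ⟨W, hW, hx₀⟩ := exists_compact_mem_nhds x₀
  obtain ⟨C, hC⟩ := (hW.prod isCompact_univ).exists_bound_of_continuousOn hφ.continuousOn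
  obtain ⟨D, hD0, hD⟩ := hV.exists_bound
  have hs : ∀ x, Continuous (φ x) := fun x => hφ.comp (by fun_prop : Continuous fun s => (x, s))
  refine continuousAt_of_dominated (bound := fun _ => ‖B‖ * C * D) (Eventually.of_forall fun x => ?_)
    ?_ (integrable_const _) (ae_of_all _ fun s => ?_)
  · have h1 : StronglyMeasurable fun s => B (φ x s) :=
      B.continuous.comp_stronglyMeasurable (hs x).stronglyMeasurable
    exact (isBoundedBilinearMap_apply.continuous.comp_stronglyMeasurable
      (h1.prodMk hV.1)).aestronglyMeasurable
  · filter_upwards [hx₀] with x hx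
    refine ae_of_all _ fun s => (B.le_opNorm₂ _ _).trans ?_
    have h1 := hC (x, s) ⟨hx, trivial⟩
    exact mul_le_mul (mul_le_mul_of_nonneg_left h1 B.opNorm_nonneg) (hD s) (norm_nonneg _)
      (mul_nonneg B.opNorm_nonneg ((norm_nonneg _).trans h1))
  · have h1 : Continuous fun x => φ x s := hφ.comp (by fun_prop : Continuous fun x => (x, s))
    exact ((B.continuous.comp h1).clm_apply continuous_const).continuousAt

/-! ### Smoothness of the Bellman extension in the action. -/

namespace MDP

variable {S : Type*} [MetricSpace S] [CompactSpace S] [MeasurableSpace S] [BorelSpace S]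
  {ν : Measure S} [IsFiniteMeasure ν] {d : ℕ} {M : MDP S ν d} {π : S → Vec d → ℝ}

lemma Regular.continuous_fderiv_trans (hM : M.Regular) :
    Continuous (Function.uncurry fun (x : S × Vec d) (s' : S) =>
      fderiv ℝ (fun a => M.trans x.1 a s') x.2) :=
  (continuousOn_univ.1 hM.partial_trans.2).comp
    (by fun_prop : Continuous fun y : (S × Vec d) × S => ((y.1.1, y.2), y.1.2))

lemma Regular.hasFDerivAt_integral_trans (hM : M.Regular) {V : S → ℝ} (hV : BddMeas V) (s : S)
    (a : Vec d) : HasFDerivAt (fun a => ∫ s', M.trans s a s' • V s' ∂ν)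
      (∫ s', V s' • fderiv ℝ (fun a => M.trans s a s') a ∂ν) a := by
  obtain ⟨D, hD0, hD⟩ := hV.exists_bound
  have hc := hM.continuous_fderiv_trans
  obtain ⟨C, hC⟩ := ((isCompact_singleton.prod (isCompact_closedBall a 1)).prod
    (isCompact_univ (X := S))).exists_bound_of_continuousOn (s := ({s} ×ˢ _) ×ˢ _) hc.continuousOn
  have ht : ∀ a, Continuous fun s' => M.trans s a s' := fun a =>
    hM.continuous_trans.comp (by fun_prop : Continuous fun s' => (s, a, s'))
  have hdt : ∀ a, Continuous fun s' => fderiv ℝ (fun a => M.trans s a s') a := fun a =>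
    hc.comp (by fun_prop : Continuous fun s' => ((s, a), s'))
  refine hasFDerivAt_integral_of_dominated_of_fderiv_le (s := Metric.closedBall a 1)
    (bound := fun _ => D * C) (F' := fun a s' => V s' • fderiv ℝ (fun a => M.trans s a s') a)
    (Metric.closedBall_mem_nhds a one_pos)
    (Eventually.of_forall fun b => ((ht b).stronglyMeasurable.smul hV.1).aestronglyMeasurable)
    ?_ (hV.1.smul (hdt a).stronglyMeasurable).aestronglyMeasurable
    (ae_of_all _ fun s' b hb => ?_) (integrable_const _) (ae_of_all _ fun s' b _ => ?_)
  · obtain ⟨C', hC'⟩ := isCompact_univ.exists_bound_of_continuousOn (ht a).continuousOn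
    refine Integrable.of_bound ((ht a).stronglyMeasurable.smul hV.1).aestronglyMeasurable (C' * D)
      (ae_of_all _ fun s' => ?_)
    rw [norm_smul]
    exact mul_le_mul (hC' s' trivial) (hD s') (norm_nonneg _)
      ((norm_nonneg _).trans (hC' s' trivial))
  · rw [norm_smul]
    exact mul_le_mul (hD s') (hC ((s, b), s') ⟨⟨rfl, hb⟩, trivial⟩) (norm_nonneg _) hD0
  · exact (hM.partial_trans.1 ((s, s'), b) trivial).hasFDerivAt.mul_const (V s')

/-- `V_π` is only bounded and measurable; all smoothness in the action comes from the reward and the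
transition density. The extension is constant in the parameter, so the `θ`-derivative is `0`. -/
lemma IsPolicy.contC1_bellmanQ (hM : M.Regular) (hπ : M.IsPolicy π) (α : ℝ) {m : ℕ}
    (Θ : Set (Vec m)) : ContC1 Θ fun _ : Vec m => M.bellmanQ α π := by
  have hV := hπ.bddMeas_stateValue hM α
  have hder : ∀ s a, HasFDerivAt (M.bellmanQ α π s) (fderiv ℝ (M.reward s) a + M.discount •
      ∫ s', M.stateValue α π s' • fderiv ℝ (fun a => M.trans s a s') a ∂ν) a := fun s a =>
    (hM.partial_reward.1 (s, a) trivial).hasFDerivAt.add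
      ((hM.hasFDerivAt_integral_trans hV s a).const_mul M.discount)
  have hcont : Continuous fun x : S × Vec d => M.bellmanQ α π x.1 x.2 := by
    refine hM.continuous_reward.add (continuous_const.mul ?_)
    exact hV.continuous_integral (ContinuousLinearMap.lsmul ℝ ℝ)
      (φ := fun (x : S × Vec d) s' => M.trans x.1 x.2 s') (hM.continuous_trans.comp
        (by fun_prop : Continuous fun y : (S × Vec d) × S => (y.1.1, y.1.2, y.2)))
  have hdcont : Continuous fun x : S × Vec d => fderiv ℝ (M.bellmanQ α π x.1) x.2 := by
    simp_rw [fun s a => (hder s a).fderiv]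
    exact (continuousOn_univ.1 hM.partial_reward.2).add ((hV.continuous_integral
      (ContinuousLinearMap.lsmul ℝ ℝ (E := Vec d →L[ℝ] ℝ)).flip
      hM.continuous_fderiv_trans).const_smul M.discount)
  refine ⟨(hcont.comp (by fun_prop : Continuous fun x : Vec m × S × Vec d =>
      (x.2.1, x.2.2))).continuousOn, ⟨fun z _ => differentiableAt_const _, ?_⟩,
    ⟨fun z _ => (hder z.1.2 z.2).differentiableAt, ?_⟩⟩
  · simpa using continuousOn_const
  · exact (hdcont.comp (by fun_prop : Continuous fun x : (Vec m × S) × Vec d =>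
      (x.1.2, x.2))).continuousOn

end MDP

/-! ### Continuity of state laws and occupancy measures in the parameter. -/

namespace ReparamMixture

variable {S : Type*} [MetricSpace S] [CompactSpace S] [MeasurableSpace S] [BorelSpace S]
  {ν : Measure S} [IsFiniteMeasure ν] {m N d : ℕ} {M : MDP S ν d} {P : ReparamMixture S m N d}
  (hM : M.Regular) (hP : P.IsPolicyOn M.A) (hreg : P.Regular) (hE : IsCompact P.E)

include hP hreg

lemma continuous_mixture_mul_log {θ : Vec m} (hθ : θ ∈ P.Θ) :
    Continuous fun x : S × Vec d => P.mixture θ x.1 x.2 * Real.log (P.mixture θ x.1 x.2) :=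
  Real.continuous_mul_log.comp (hreg.contC1_mixture.continuous_of_mem hθ)

include hE

/-- The entropy is bounded even where the density vanishes, since `x log x` is continuous at `0`. -/
lemma isPolicy_mixture {θ : Vec m} (hθ : θ ∈ P.Θ) : M.IsPolicy (P.mixture θ) where
  measurable := hreg.measurable_mixture hθ
  nonneg s _ ha := hP.mixture_nonneg hθ s ha
  integral_eq_one s := hP.integral_mixture hreg M.measurableSet_A hE.measurableSet hθ s
  entropy := by
    have hc := continuous_mixture_mul_log hP hreg hθ
    have hfin : IsFiniteMeasure (volume.restrict M.A) :=
      ⟨by rw [Measure.restrict_apply_univ]; exact M.isCompact_A.measure_lt_top⟩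
    obtain ⟨C, hC⟩ := (isCompact_univ.prod M.isCompact_A).exists_bound_of_continuousOn
      hc.continuousOn
    refine ⟨(hc.stronglyMeasurable.integral_prod_right' (ν := volume.restrict M.A)).neg,
      C * (volume.restrict M.A).real Set.univ, fun s => ?_⟩
    rw [MDP.entropy, norm_neg]
    refine norm_integral_le_of_norm_le_const ?_
    filter_upwards [ae_restrict_mem M.measurableSet_A] with a ha using hC (s, a) ⟨trivial, ha⟩

variable {B : S → Vec d → ℝ} {U : Set (Vec m)} {K : ℝ} (hU : LocalBound P M.A B U K) (α : ℝ)
include hU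

/-- The entropy is itself an expectation of `-log π`, so it joins `B` under one integral, which is
then reparameterized by the noise. -/
lemma LocalBound.integral_reg (hB : ContC1 P.Θ fun _ : Vec m => B) {θ : Vec m} (hθ : θ ∈ U)
    (s : S) : (∫ a in M.A, P.mixture θ s a * B s a) + α * M.entropy (P.mixture θ) s =
      ∑ k, P.weight θ s k * ∫ ε, P.reg B α θ s (P.f θ s k ε) ∂P.noiseLaw := by
  have hθ' := hU.subset hθ
  have hs : Continuous fun a : Vec d => (s, a) := by fun_prop
  have h := hP.integral_mixture_smul hreg M.measurableSet_A hθ' s (q := P.reg B α θ s)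
    ((hreg.stronglyMeasurable_reg hB α hθ').comp_measurable hs.measurable)
    fun k => hU.integrable_reg_path hP hreg hB α hE hθ s k
  simp only [smul_eq_mul] at h
  rw [← h, MDP.entropy, mul_neg, ← sub_eq_add_neg, ← integral_const_mul, ← integral_sub]
  · congr 1 with a
    rw [reg]; ring
  · exact (((hreg.contC1_mixture.continuous_of_mem hθ').mul
      (hB.continuous_of_mem hθ')).comp hs).continuousOn.integrableOn_compact M.isCompact_A
  · exact (((continuous_mixture_mul_log hP hreg hθ').comp hs).continuousOn.integrableOn_compact
      M.isCompact_A).const_mul α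

omit hE in
lemma LocalBound.norm_mixture_sub_le {θ θ' : Vec m} (hθ : θ ∈ U) (hθ' : θ' ∈ U) (s : S)
    {a : Vec d} (ha : a ∈ M.A) : ‖P.mixture θ' s a - P.mixture θ s a‖ ≤ K * ‖θ' - θ‖ :=
  hU.convex.norm_image_sub_le_of_norm_hasFDerivWithin_le
    (fun _ hx => (hreg.contC1_mixture.hasFDerivAt_param (hU.subset hx) s a).hasFDerivWithinAt)
    (fun x hx => hU.fderiv_mixture_param x hx s a ha) hθ hθ'

include hM
variable {F : Type*} [NormedAddCommGroup F] [NormedSpace ℝ F]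

/-- The mixture density is `K`-Lipschitz in `θ` on `U`, while the transition average of `h` stays
bounded by `D`. Integrating over `A` adds the factor of its volume. -/
lemma LocalBound.norm_stateStep_sub_le {h : S → F} (hh : BddMeas h) :
    ∃ C, ∀ θ ∈ U, ∀ θ' ∈ U, ∀ s,
      ‖M.stateStep (P.mixture θ') h s - M.stateStep (P.mixture θ) h s‖ ≤ C * ‖θ' - θ‖ := by
  obtain ⟨D, hD0, hD⟩ := hh.exists_bound
  have := hM.isMarkovKernel_transKernel
  have hfin : IsFiniteMeasure (volume.restrict M.A) :=
    ⟨by rw [Measure.restrict_apply_univ]; exact M.isCompact_A.measure_lt_top⟩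
  refine ⟨K * D * (volume.restrict M.A).real Set.univ, fun θ hθ θ' hθ' s => ?_⟩
  have hs : Continuous fun a : Vec d => (s, a) := by fun_prop
  set q : Vec d → F := fun a => ∫ s', M.trans s a s' • h s' ∂ν with hq
  have hqc : Continuous q := by
    have := hh.continuous_integral (ν := ν) (ContinuousLinearMap.lsmul ℝ ℝ)
      (φ := fun (x : S × Vec d) s' => M.trans x.1 x.2 s') (hM.continuous_trans.comp
        (by fun_prop : Continuous fun y : (S × Vec d) × S => (y.1.1, y.1.2, y.2)))
    exact this.comp hs
  have hqb : ∀ a ∈ M.A, ‖q a‖ ≤ D := fun a ha => by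
    have := hM.integral_transKernel h (s, ⟨a, ha⟩)
    simp only [hq]
    rw [← this]
    exact BddMeas.norm_integral_le hD _
  have e : ∀ ϑ ∈ U, M.stateStep (P.mixture ϑ) h s = ∫ a in M.A, P.mixture ϑ s a • q a := by
    intro ϑ hϑ
    rw [← (isPolicy_mixture hP hreg hE (hU.subset hϑ)).integral_policyKernel q s, MDP.stateStep]
    simp only [hM.integral_transKernel, hq]
  have hi : ∀ ϑ ∈ U, IntegrableOn (fun a => P.mixture ϑ s a • q a) M.A := fun ϑ hϑ =>
    (((hreg.contC1_mixture.continuous_of_mem (hU.subset hϑ)).comp hs).smul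
      hqc).continuousOn.integrableOn_compact M.isCompact_A
  rw [e θ hθ, e θ' hθ', ← integral_sub (hi θ' hθ') (hi θ hθ)]
  refine (norm_integral_le_of_norm_le_const (C := K * ‖θ' - θ‖ * D) ?_).trans_eq (by ring)
  filter_upwards [ae_restrict_mem M.measurableSet_A] with a ha
  rw [← sub_smul, norm_smul]
  exact mul_le_mul (hU.norm_mixture_sub_le hP hreg hθ hθ' s ha) (hqb a ha) (norm_nonneg _)
    (mul_nonneg hU.nonneg (norm_nonneg _))

lemma LocalBound.tendsto_integral_stateLaw {θ : Vec m} (hθ : θ ∈ U) (t : ℕ) {h : S → F}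
    (hh : BddMeas h) : Tendsto (fun θ' => ∫ s, h s ∂M.stateLaw (P.mixture θ') t) (𝓝 θ)
      (𝓝 (∫ s, h s ∂M.stateLaw (P.mixture θ) t)) := by
  have := hM.isMarkovKernel_transKernel
  have hpol : ∀ θ' ∈ U, IsMarkovKernel (M.policyKernel (P.mixture θ')) := fun θ' h =>
    (isPolicy_mixture hP hreg hE (hU.subset h)).isMarkovKernel_policyKernel
  have := hpol θ hθ
  have hnhds := hU.isOpen.mem_nhds hθ
  induction t generalizing h with
  | zero =>
    refine tendsto_const_nhds.congr' ?_
    filter_upwards [hnhds] with θ' hθ'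
    have := hpol θ' hθ'
    rw [MDP.stateLaw_zero, MDP.stateLaw_zero]
  | succ t ih =>
    rw [MDP.integral_stateLaw_succ hh]
    -- The last step is first taken with the fixed policy `π_θ`, so the induction hypothesis applies
    -- to `P_{π_θ} h`. Replacing `π_θ` by `π_θ'` in that step costs at most `C ‖θ' - θ‖`, uniformly
    -- in the state.
    refine tendsto_of_tendsto_of_dist (ih (hh.stateStep (M := M) (π := P.mixture θ))) ?_
    obtain ⟨C, hC⟩ := hU.norm_stateStep_sub_le hM hP hreg hE hh
    have hlim : Tendsto (fun θ' => C * ‖θ' - θ‖) (𝓝 θ) (𝓝 0) := by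
      have : Continuous fun θ' => C * ‖θ' - θ‖ := by fun_prop
      simpa using this.tendsto θ
    refine tendsto_of_tendsto_of_tendsto_of_le_of_le' tendsto_const_nhds hlim
      (Eventually.of_forall fun _ => dist_nonneg) ?_
    filter_upwards [hnhds] with θ' hθ'
    have := hpol θ' hθ'
    rw [MDP.integral_stateLaw_succ hh, dist_comm, dist_eq_norm, ← integral_sub
      ((hh.stateStep (M := M) (π := P.mixture θ')).integrable _)
      ((hh.stateStep (M := M) (π := P.mixture θ)).integrable _)]
    exact BddMeas.norm_integral_le (fun s => hC θ hθ θ' hθ' s) _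

lemma LocalBound.tendsto_integral_occupancy [CompleteSpace F] {θ : Vec m} (hθ : θ ∈ U) {h : S → F}
    (hh : BddMeas h) : Tendsto (fun θ' => ∫ s, h s ∂M.occupancy (P.mixture θ')) (𝓝 θ)
      (𝓝 (∫ s, h s ∂M.occupancy (P.mixture θ))) := by
  have := hM.isMarkovKernel_transKernel
  have hpol : ∀ θ' ∈ U, IsMarkovKernel (M.policyKernel (P.mixture θ')) := fun θ' h =>
    (isPolicy_mixture hP hreg hE (hU.subset h)).isMarkovKernel_policyKernel
  have := hpol θ hθ
  have hnhds := hU.isOpen.mem_nhds hθ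
  obtain ⟨C, hC0, hC⟩ := hh.exists_bound
  have key := tendsto_tsum_of_dominated_convergence (𝓕 := 𝓝 θ)
    (f := fun θ' t => M.discount ^ t • ∫ s, h s ∂M.stateLaw (P.mixture θ') t)
    (bound := fun t => M.discount ^ t * C)
    ((summable_geometric_of_lt_one M.discount_nonneg M.discount_lt_one).mul_right C)
    (fun t => (hU.tendsto_integral_stateLaw hM hP hreg hE hθ t hh).const_smul _) (by
      filter_upwards [hnhds] with θ' hθ' t
      have := hpol θ' hθ'
      rw [norm_smul, Real.norm_of_nonneg (pow_nonneg M.discount_nonneg t)]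
      exact mul_le_mul_of_nonneg_left (BddMeas.norm_integral_le hC _)
        (pow_nonneg M.discount_nonneg t))
  rw [(MDP.hasSum_integral_occupancy hh).tsum_eq] at key
  refine key.congr' ?_
  filter_upwards [hnhds] with θ' hθ'
  have := hpol θ' hθ'
  exact (MDP.hasSum_integral_occupancy hh).tsum_eq

end ReparamMixture

/-! ### The derivative of the objective as an integral over states. -/

namespace ReparamMixture

variable {S : Type*} [MetricSpace S] [CompactSpace S] [MeasurableSpace S] [BorelSpace S]
  {ν : Measure S} [IsFiniteMeasure ν] {m N d : ℕ} {M : MDP S ν d} {P : ReparamMixture S m N d}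
  {B : S → Vec d → ℝ}

lemma measurable_of_forall_component {Y : Type*} [MeasurableSpace Y] {h : S → Fin N → Vec d → Y}
    (hh : ∀ k, Measurable fun x : S × Vec d => h x.1 k x.2) :
    Measurable fun x : S × Fin N × Vec d => h x.1 x.2.1 x.2.2 := by
  have h1 : Measurable fun y : Fin N × S × Vec d => h y.2.1 y.1 y.2.2 :=
    measurable_from_prod_countable_right hh
  exact h1.comp (by fun_prop : Measurable fun x : S × Fin N × Vec d => (x.2.1, x.1, x.2.2))

section Gradient

variable (hreg : P.Regular) (hB : ContC1 P.Θ fun _ : Vec m => B) (α : ℝ)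
include hreg

lemma Regular.measurable_weight {θ : Vec m} (hθ : θ ∈ P.Θ) (k : Fin N) :
    Measurable fun s => P.weight θ s k :=
  ((hreg.continuousOn_weight k).comp_continuous (f := fun s : S => (θ, s)) (by fun_prop)
    fun _ => hθ).measurable

include hB

lemma Regular.stronglyMeasurable_gradForm {θ : Vec m} (hθ : θ ∈ P.Θ) (k : Fin N) :
    StronglyMeasurable fun x : S × Vec d => P.gradForm B α θ (x.1, k, x.2) := by
  have h1 : StronglyMeasurable fun x : S × Vec d => P.reg B α θ x.1 (P.f θ x.1 k x.2) :=
    (hreg.stronglyMeasurable_reg hB α hθ).comp_measurable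
      (measurable_fst.prodMk (hreg.measurable_f hθ k))
  have h2 : StronglyMeasurable fun x : S × Vec d => fderiv ℝ (fun θ' => P.weight θ' x.1 k) θ :=
    ((hreg.continuousOn_fderiv_weight k).comp_continuous (f := fun x : S × Vec d => (θ, x.1))
      (by fun_prop) fun _ => hθ).stronglyMeasurable
  have h3 : StronglyMeasurable fun x : S × Vec d => (P.weight θ x.1 k)⁻¹ :=
    ((hreg.measurable_weight hθ k).comp measurable_fst).inv.stronglyMeasurable
  exact ((h1.mul h3).smul h2).add (hreg.stronglyMeasurable_pathDeriv hB α hθ k)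

variable {U : Set (Vec m)} {K : ℝ} (hM : M.Regular) (hP : P.IsPolicyOn M.A)
  (hU : LocalBound P M.A B U K) (hE : IsCompact P.E)
include hP hU hE

/-- The expected integrand of the policy gradient in the state `s`. -/
noncomputable def stateGrad (P : ReparamMixture S m N d) (B : S → Vec d → ℝ) (α : ℝ) (θ : Vec m)
    (s : S) : Vec m →L[ℝ] ℝ :=
  ∑ k, P.weight θ s k • ∫ ε, P.gradForm B α θ (s, k, ε) ∂P.noiseLaw

/-- Uniformity over `U` turns `L` into a Lipschitz constant for the lookahead value via the mean
value inequality. -/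
lemma LocalBound.norm_stateGrad_le :
    ∃ L, 0 ≤ L ∧ ∀ θ ∈ U, ∀ s, ‖P.stateGrad B α θ s‖ ≤ L := by
  have hK := hU.nonneg
  set C := (K + |α| * (K + K * K)) * (K * K) + (K + |α| * (K * K * K)) * K with hC
  have hC0 : 0 ≤ C := by positivity
  set I := ∫ ε, C * P.noiseBound ε ∂P.noiseLaw with hI
  have hgood := hP.ae_goodNoise hreg hE.measurableSet
  have hI0 : 0 ≤ I := integral_nonneg_of_ae (by
    filter_upwards [hgood] with ε hε using mul_nonneg hC0 hε.noiseBound_nonneg)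
  refine ⟨∑ _ : Fin N, K * I, by positivity, fun θ hθ s => ?_⟩
  refine norm_sum_le_of_le _ fun k _ => ?_
  rw [norm_smul]
  refine mul_le_mul (hU.weight θ hθ s k) ?_ (norm_nonneg _) hK
  refine norm_integral_le_of_norm_le ((hreg.integrable_noiseBound hE).const_mul C) ?_
  filter_upwards [hgood] with ε hε
    using hU.norm_gradForm_le hP hreg hB α hE hθ s k hε

lemma LocalBound.bddMeas_stateGrad {θ : Vec m} (hθ : θ ∈ U) :
    BddMeas (P.stateGrad B α θ) := by
  obtain ⟨L, -, hL⟩ := hU.norm_stateGrad_le hreg hB α hP hE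
  have := hP.isProbabilityMeasure_noiseLaw hE.measurableSet
  refine ⟨?_, L, hL θ hθ⟩
  have hk : ∀ k, StronglyMeasurable fun s =>
      P.weight θ s k • ∫ ε, P.gradForm B α θ (s, k, ε) ∂P.noiseLaw := fun k =>
    (hreg.measurable_weight (hU.subset hθ) k).stronglyMeasurable.smul
      (hreg.stronglyMeasurable_gradForm hB α (hU.subset hθ) k).integral_prod_right'
  exact Finset.stronglyMeasurable_fun_sum _ fun k _ => hk k

end Gradient

/-- The policy gradient as a linear functional. -/
lemma hasFDerivAt_objective (hM : M.Regular) (hP : P.IsPolicyOn M.A) (hreg : P.Regular)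
    (hE : IsCompact P.E) (α : ℝ) {θ : Vec m} (hθ : θ ∈ P.Θ) :
    HasFDerivAt (fun θ' => M.objective α (P.mixture θ'))
      (∫ s, P.stateGrad (M.bellmanQ α (P.mixture θ)) α θ s ∂M.occupancy (P.mixture θ)) θ := by
  have hT := hM.isMarkovKernel_transKernel
  have hπ := isPolicy_mixture hP hreg hE hθ
  have hB : ContC1 P.Θ fun _ : Vec m => M.bellmanQ α (P.mixture θ) := hπ.contC1_bellmanQ hM α P.Θ
  obtain ⟨U, K, hθU, hU⟩ := exists_localBound hP hreg hB M.isCompact_A hE hθ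
  have hnhds := hU.isOpen.mem_nhds hθU
  have hpol : ∀ θ' ∈ U, M.IsPolicy (P.mixture θ') := fun θ' h =>
    isPolicy_mixture hP hreg hE (hU.subset h)
  -- The action value belongs to the fixed `θ`; only the policy it is averaged against varies with
  -- `θ'`.
  have hg : ∀ θ' ∈ U, ∀ s, M.lookahead α (P.mixture θ) (P.mixture θ') s =
      ∑ k, P.weight θ' s k * ∫ ε, P.reg (M.bellmanQ α (P.mixture θ)) α θ' s (P.f θ' s k ε)
        ∂P.noiseLaw := fun θ' h s => hU.integral_reg hP hreg hE α hB h s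
  have hder : ∀ θ' ∈ U, ∀ s, HasFDerivAt
      (fun θ' => M.lookahead α (P.mixture θ) (P.mixture θ') s)
      (P.stateGrad (M.bellmanQ α (P.mixture θ)) α θ' s) θ' := fun θ' h s =>
    (hU.hasFDerivAt_sum hP hreg hB α M.isCompact_A hE h s).congr_of_eventuallyEq (by
      filter_upwards [hU.isOpen.mem_nhds h] with θ'' h'' using hg θ'' h'' s)
  obtain ⟨L, hL0, hL⟩ := hU.norm_stateGrad_le hreg hB α hP hE
  have hG := hU.bddMeas_stateGrad hreg hB α hP hE hθU
  obtain ⟨C, hC, hocc⟩ := MDP.exists_occupancy_le hM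
  have key := hasFDerivAt_integral_sub_of_dominated (ν := ν)
    (μ := fun θ' => M.occupancy (P.mixture θ'))
    (g := fun θ' => M.lookahead α (P.mixture θ) (P.mixture θ')) hC
    (by
      filter_upwards [hnhds] with θ' h
      have := (hpol θ' h).isMarkovKernel_policyKernel
      exact hocc _)
    (by filter_upwards [hnhds] with θ' h using hπ.bddMeas_lookahead hM α (hpol θ' h))
    hG hL0
    (by
      filter_upwards [hnhds] with θ' h s
      exact hU.convex.norm_image_sub_le_of_norm_hasFDerivWithin_le
        (fun x hx => (hder x hx s).hasFDerivWithinAt) (fun x hx => hL x hx s) hθU h)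
    (hder θ hθU) (hU.tendsto_integral_occupancy hM hP hreg hE hθU hG)
  refine (key.add_const (M.objective α (P.mixture θ))).congr_of_eventuallyEq ?_
  filter_upwards [hnhds] with θ' h
  rw [← hπ.objective_sub hM α (hpol θ' h), sub_add_cancel]

/-! ### The joint law of state, component and noise. -/

section Sampling

variable (hM : M.Regular) (hP : P.IsPolicyOn M.A) (hreg : P.Regular) (hE : IsCompact P.E)
include hP hreg

lemma measurable_ofReal_weight {θ : Vec m} (hθ : θ ∈ P.Θ) :
    Measurable (Function.uncurry fun (s : S) (k : Fin N) => ENNReal.ofReal (P.weight θ s k)) :=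
  measurable_from_prod_countable_left fun k => (hreg.measurable_weight hθ k).ennreal_ofReal

lemma isMarkovKernel_weightKernel {θ : Vec m} (hθ : θ ∈ P.Θ) :
    IsMarkovKernel (P.weightKernel θ) := by
  refine ⟨fun s => ⟨?_⟩⟩
  rw [weightKernel, Kernel.withDensity_apply _ (measurable_ofReal_weight hP hreg hθ),
    Kernel.const_apply, withDensity_apply _ MeasurableSet.univ, Measure.restrict_univ,
    lintegral_count, tsum_fintype, ← ENNReal.ofReal_sum_of_nonneg
    (fun k _ => (hP.weight_pos θ hθ s k).le), hP.sum_weight θ hθ s, ENNReal.ofReal_one]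

lemma integral_weightKernel {F : Type*} [NormedAddCommGroup F] [NormedSpace ℝ F]
    [CompleteSpace F] {θ : Vec m} (hθ : θ ∈ P.Θ) (s : S) (h : Fin N → F) :
    ∫ k, h k ∂P.weightKernel θ s = ∑ k, P.weight θ s k • h k := by
  rw [weightKernel, Kernel.withDensity_apply _ (measurable_ofReal_weight hP hreg hθ),
    Kernel.const_apply, integral_withDensity_eq_integral_toReal_smul
      (measurable_of_countable _) (ae_of_all _ fun _ => ENNReal.ofReal_lt_top), integral_count]
  simp_rw [ENNReal.toReal_ofReal (hP.weight_pos θ hθ s _).le]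

include hE hM

/-- The noise is drawn independently of state and component, so its marginal is `noiseLaw` scaled by
the total mass of `d_π`. Almost-sure and integrability statements about `ε` transfer through this
identity. -/
lemma sampling_map_noise {θ : Vec m} (hθ : θ ∈ P.Θ) :
    (P.sampling M θ).map (fun x => x.2.2) =
      M.occupancy (P.mixture θ) Set.univ • P.noiseLaw := by
  have := hP.isProbabilityMeasure_noiseLaw hE.measurableSet
  have := isMarkovKernel_weightKernel hP hreg hθ
  have := hM.isMarkovKernel_transKernel
  have := (isPolicy_mixture hP hreg hE hθ).isMarkovKernel_policyKernel
  ext T hT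
  have hm : Measurable fun x : S × Fin N × Vec d => x.2.2 := by fun_prop
  rw [Measure.map_apply hm hT, sampling, Measure.compProd_apply (hm hT)]
  have : ∀ s, (P.weightKernel θ ×ₖ Kernel.const S P.noiseLaw) s
      (Prod.mk s ⁻¹' ((fun x : S × Fin N × Vec d => x.2.2) ⁻¹' T)) = P.noiseLaw T := by
    intro s
    have e : Prod.mk s ⁻¹' ((fun x : S × Fin N × Vec d => x.2.2) ⁻¹' T) =
        Set.univ ×ˢ T := by ext; simp
    rw [e, Kernel.prod_apply, Measure.prod_prod, measure_univ, one_mul, Kernel.const_apply]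
  simp_rw [this]
  rw [lintegral_const, Measure.smul_apply, smul_eq_mul, mul_comm]

lemma ae_sampling_of_ae_noise {θ : Vec m} (hθ : θ ∈ P.Θ) {p : Vec d → Prop}
    (hp : ∀ᵐ ε ∂P.noiseLaw, p ε) : ∀ᵐ x ∂P.sampling M θ, p x.2.2 := by
  refine ae_of_ae_map (f := fun x : S × Fin N × Vec d => x.2.2) (by fun_prop) ?_
  rw [sampling_map_noise hM hP hreg hE hθ]
  exact Measure.ae_smul_measure hp _

lemma integrable_noiseBound_sampling {θ : Vec m} (hθ : θ ∈ P.Θ) :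
    Integrable (fun x => P.noiseBound x.2.2) (P.sampling M θ) := by
  have := hM.isMarkovKernel_transKernel
  have := (isPolicy_mixture hP hreg hE hθ).isMarkovKernel_policyKernel
  have h : Integrable P.noiseBound ((P.sampling M θ).map fun x => x.2.2) := by
    rw [sampling_map_noise hM hP hreg hE hθ]
    exact (hreg.integrable_noiseBound hE).smul_measure (measure_ne_top _ _)
  exact h.comp_measurable (by fun_prop)

/-- A Lebesgue null set of actions is almost surely not hit. -/
lemma ae_sampling_of_ae_action {θ : Vec m} (hθ : θ ∈ P.Θ) {p : Vec d → Prop}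
    (hp : ∀ᵐ a ∂volume.restrict M.A, p a) :
    ∀ᵐ x ∂P.sampling M θ, p (P.f θ x.1 x.2.1 x.2.2) := by
  have := hP.isProbabilityMeasure_noiseLaw hE.measurableSet
  have := isMarkovKernel_weightKernel hP hreg hθ
  have := hM.isMarkovKernel_transKernel
  have := (isPolicy_mixture hP hreg hE hθ).isMarkovKernel_policyKernel
  -- The exceptional set of actions need not be measurable, so it is enlarged to a measurable null
  -- set.
  set T := toMeasurable (volume.restrict M.A) {a | ¬p a} with hT
  have hTm : MeasurableSet T := measurableSet_toMeasurable _ _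
  have hT0 : volume.restrict M.A T = 0 := by rw [measure_toMeasurable]; exact hp
  have hfm : Measurable fun x : S × Fin N × Vec d => P.f θ x.1 x.2.1 x.2.2 :=
    measurable_of_forall_component fun k => hreg.measurable_f hθ k
  have key : ∀ᵐ x ∂P.sampling M θ, P.f θ x.1 x.2.1 x.2.2 ∉ T := by
    have hms : MeasurableSet {x : S × Fin N × Vec d | P.f θ x.1 x.2.1 x.2.2 ∉ T} := hfm hTm.compl
    refine (Measure.ae_compProd_iff hms).2 (ae_of_all _ fun s => ?_)
    rw [Kernel.prod_apply, Kernel.const_apply]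
    refine (Measure.ae_prod_iff_ae_ae (measurable_prodMk_left hms)).2 (ae_of_all _ fun k => ?_)
    have hc := (hP.continuous_f hreg hθ s k).measurable
    refine ae_of_ae_map (p := fun a => a ∉ T) hc.aemeasurable ?_
    -- The law of `f_θ(ε; s, k)` has a density on `A`, hence charges no Lebesgue null set.
    rw [hP.map_noise θ hθ s k]
    exact (withDensity_absolutelyContinuous _ _).ae_le (measure_eq_zero_iff_ae_notMem.1 hT0)
  filter_upwards [key] with x hx
  by_contra hne
  exact hx (subset_toMeasurable _ _ hne)

variable {B : S → Vec d → ℝ} {U : Set (Vec m)} {K : ℝ} (hU : LocalBound P M.A B U K)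
  (hB : ContC1 P.Θ fun _ : Vec m => B) (α : ℝ)
include hU hB

lemma LocalBound.integrable_gradForm {θ : Vec m} (hθ : θ ∈ U) :
    Integrable (P.gradForm B α θ) (P.sampling M θ) := by
  have hθ' := hU.subset hθ
  have hm : StronglyMeasurable (P.gradForm B α θ) :=
    (measurable_of_forall_component (h := fun s k ε => P.gradForm B α θ (s, k, ε)) fun k =>
      (hreg.stronglyMeasurable_gradForm hB α hθ' k).measurable).stronglyMeasurable
  refine ((integrable_noiseBound_sampling hM hP hreg hE hθ').const_mul
    ((K + |α| * (K + K * K)) * (K * K) + (K + |α| * (K * K * K)) * K)).mono'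
    hm.aestronglyMeasurable ?_
  filter_upwards [ae_sampling_of_ae_noise hM hP hreg hE hθ'
    (hP.ae_goodNoise hreg hE.measurableSet)] with x hx
    using hU.norm_gradForm_le hP hreg hB α hE hθ x.1 x.2.1 hx

lemma LocalBound.integral_gradForm {θ : Vec m} (hθ : θ ∈ U) :
    ∫ x, P.gradForm B α θ x ∂P.sampling M θ =
      ∫ s, P.stateGrad B α θ s ∂M.occupancy (P.mixture θ) := by
  have hθ' := hU.subset hθ
  have := hP.isProbabilityMeasure_noiseLaw hE.measurableSet
  have := isMarkovKernel_weightKernel hP hreg hθ'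
  have := hM.isMarkovKernel_transKernel
  have := (isPolicy_mixture hP hreg hE hθ').isMarkovKernel_policyKernel
  have hi := hU.integrable_gradForm hM hP hreg hE hB α hθ
  unfold sampling at hi ⊢
  rw [Measure.integral_compProd hi]
  refine integral_congr_ae ?_
  filter_upwards [((Measure.integrable_compProd_iff hi.1).1 hi).1] with s hs
  rw [Kernel.prod_apply, Kernel.const_apply] at hs ⊢
  rw [integral_prod _ hs, integral_weightKernel hP hreg hθ']
  rfl

end Sampling

end ReparamMixture

/-! ### Identification of the gradient formula. -/

namespace ReparamMixture

variable {S : Type*} [MetricSpace S] [CompactSpace S] [MeasurableSpace S] [BorelSpace S]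
  {ν : Measure S} [IsFiniteMeasure ν] {m N d : ℕ} {M : MDP S ν d} {P : ReparamMixture S m N d}
  (hM : M.Regular) (hP : P.IsPolicyOn M.A) (hreg : P.Regular) (hE : IsCompact P.E) (α : ℝ)

include hM hP hreg hE

lemma hasFDerivWithinAt_regQ {θ : Vec m} (hθ : θ ∈ P.Θ) (s : S) {a : Vec d} (ha : a ∈ M.A)
    (hpos : 0 < P.mixture θ s a) :
    HasFDerivWithinAt (P.regQ M α θ s)
      (P.regDeriv (M.bellmanQ α (P.mixture θ)) α θ s a) M.A a := by
  have hπ := isPolicy_mixture hP hreg hE hθ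
  have hB : ContC1 P.Θ fun _ : Vec m => M.bellmanQ α (P.mixture θ) := hπ.contC1_bellmanQ hM α P.Θ
  have h1 : HasFDerivAt (P.reg (M.bellmanQ α (P.mixture θ)) α θ s)
      (P.regDeriv (M.bellmanQ α (P.mixture θ)) α θ s a) a := by
    refine ((hB.hasFDerivAt_var hθ s a).sub
      (((hreg.contC1_mixture.hasFDerivAt_var hθ s a).log hpos.ne').const_mul α)).congr_fderiv ?_
    rw [smul_smul]; rfl
  have h2 : ∀ b ∈ M.A, P.regQ M α θ s b = P.reg (M.bellmanQ α (P.mixture θ)) α θ s b :=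
    fun b hb => by rw [regQ, hπ.softQ_eq hM α s hb, reg]
  exact h1.hasFDerivWithinAt.congr h2 (h2 a ha)

/-- Where derivatives within the action set are unique, `halfReparam` represents `gradForm`. -/
lemma halfReparam_eq {θ : Vec m} (hθ : θ ∈ P.Θ) {x : S × Fin N × Vec d}
    (ha : P.f θ x.1 x.2.1 x.2.2 ∈ M.A) (hpos : 0 < P.mixture θ x.1 (P.f θ x.1 x.2.1 x.2.2))
    (huniq : ∀ (h : Vec d → ℝ) (D D' : Vec d →L[ℝ] ℝ),
      HasFDerivWithinAt h D M.A (P.f θ x.1 x.2.1 x.2.2) →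
      HasFDerivWithinAt h D' M.A (P.f θ x.1 x.2.1 x.2.2) → D = D') :
    P.halfReparam M α θ x = (InnerProductSpace.toDual ℝ (Vec m)).symm
      (P.gradForm (M.bellmanQ α (P.mixture θ)) α θ x) := by
  obtain ⟨s, k, ε⟩ := x
  have hπ := isPolicy_mixture hP hreg hE hθ
  have hD := hasFDerivWithinAt_regQ hM hP hreg hE α hθ s ha hpos
  -- `fderivWithin` is some derivative within `A`; uniqueness forces it to be the restriction of the
  -- derivative of the Bellman extension.
  have hfd : fderivWithin ℝ (P.regQ M α θ s) M.A (P.f θ s k ε) =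
      P.regDeriv (M.bellmanQ α (P.mixture θ)) α θ s (P.f θ s k ε) :=
    huniq _ _ _ hD.differentiableWithinAt.hasFDerivWithinAt hD
  have hq : P.regQ M α θ s (P.f θ s k ε) =
      P.reg (M.bellmanQ α (P.mixture θ)) α θ s (P.f θ s k ε) := by
    rw [regQ, hπ.softQ_eq hM α s ha, reg]
  have hw : fderiv ℝ (fun θ' => Real.log (P.weight θ' s k)) θ =
      (P.weight θ s k)⁻¹ • fderiv ℝ (fun θ' => P.weight θ' s k) θ :=
    ((hreg.hasFDerivAt_weight hθ s k).log (hP.weight_pos θ hθ s k).ne').fderiv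
  refine ext_inner_right ℝ fun v => ?_
  rw [InnerProductSpace.toDual_symm_apply]
  simp only [halfReparam, gradForm, pathDeriv, gradientWithin, gradient, hq, hw, hfd,
    inner_add_left, inner_smul_left, ContinuousLinearMap.adjoint_inner_left,
    InnerProductSpace.toDual_symm_apply]
  simp [mul_assoc]

end ReparamMixture

theorem mainTheorem3 {S : Type*} [MetricSpace S] [CompactSpace S] [MeasurableSpace S]
    [BorelSpace S] (ν : Measure S) [IsFiniteMeasure ν] {m N d : ℕ} (M : MDP S ν d)
    (P : ReparamMixture S m N d) (α : ℝ) (hM : M.Regular) (hP : P.IsPolicyOn M.A)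
    (hreg : P.Regular) (θ : Vec m) (hθ : θ ∈ P.Θ) :
    (∀ᵐ x ∂(P.sampling M θ),
      P.f θ x.1 x.2.1 x.2.2 ∈ M.A ∧ 0 < P.mixture θ x.1 (P.f θ x.1 x.2.1 x.2.2) ∧
        DifferentiableWithinAt ℝ (P.regQ M α θ x.1) M.A (P.f θ x.1 x.2.1 x.2.2)) ∧
      Integrable (P.halfReparam M α θ) (P.sampling M θ) ∧
      HasGradientAt (fun θ' => M.objective α (P.mixture θ'))
        (∫ x, P.halfReparam M α θ x ∂(P.sampling M θ)) θ := by
  -- Compactness of `E` requires some state and some component. Both exist, since an empty integral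
  -- or an empty sum of probabilities would be `0` instead of `1`.
  obtain ⟨s₀⟩ : Nonempty S := by
    by_contra hne
    rw [not_nonempty_iff] at hne
    simpa [integral, Measure.eq_zero_of_isEmpty ν] using M.integral_init
  obtain ⟨k₀⟩ : Nonempty (Fin N) := by
    by_contra hne
    rw [not_nonempty_iff] at hne
    simpa using hP.sum_weight θ hθ s₀
  have hE := hP.isCompact_E hreg M.isCompact_A hθ s₀ k₀
  have hπ := ReparamMixture.isPolicy_mixture hP hreg hE hθ
  have hB : ContC1 P.Θ fun _ : Vec m => M.bellmanQ α (P.mixture θ) := hπ.contC1_bellmanQ hM α P.Θ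
  obtain ⟨U, K, hθU, hU⟩ := ReparamMixture.exists_localBound hP hreg hB M.isCompact_A hE hθ
  have hgood : ∀ᵐ x ∂P.sampling M θ,
      P.f θ x.1 x.2.1 x.2.2 ∈ M.A ∧ 0 < P.mixture θ x.1 (P.f θ x.1 x.2.1 x.2.2) := by
    filter_upwards [ReparamMixture.ae_sampling_of_ae_noise hM hP hreg hE hθ
      (hP.ae_goodNoise hreg hE.measurableSet)] with x hx
    exact ⟨hP.mapsTo θ hθ x.1 x.2.1 hx.1, (hU.mixture_pos hP hθU x.1 x.2.1 hx).1⟩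
  have heq : P.halfReparam M α θ =ᵐ[P.sampling M θ] fun x =>
      (InnerProductSpace.toDual ℝ (Vec m)).symm
        (P.gradForm (M.bellmanQ α (P.mixture θ)) α θ x) := by
    filter_upwards [hgood, ReparamMixture.ae_sampling_of_ae_action hM hP hreg hE hθ
      (ae_eq_of_hasFDerivWithinAt volume M.measurableSet_A)] with x hx hu
    exact ReparamMixture.halfReparam_eq hM hP hreg hE α hθ hx.1 hx.2 hu
  have hi := hU.integrable_gradForm hM hP hreg hE hB α hθU
  have hint : Integrable (P.halfReparam M α θ) (P.sampling M θ) := by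
    refine (hi.norm.mono' ?_ (ae_of_all _ fun x => ?_) : Integrable (fun x =>
      (InnerProductSpace.toDual ℝ (Vec m)).symm
        (P.gradForm (M.bellmanQ α (P.mixture θ)) α θ x)) _).congr heq.symm
    · exact (InnerProductSpace.toDual ℝ (Vec m)).symm.continuous.comp_aestronglyMeasurable hi.1
    · rw [LinearIsometryEquiv.norm_map]
  refine ⟨?_, hint, ?_⟩
  · filter_upwards [hgood] with x hx
    exact ⟨hx.1, hx.2, (ReparamMixture.hasFDerivWithinAt_regQ hM hP hreg hE α hθ x.1 hx.1
      hx.2).differentiableWithinAt⟩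
  · rw [hasGradientAt_iff_hasFDerivAt]
    refine (ReparamMixture.hasFDerivAt_objective hM hP hreg hE α hθ).congr_fderiv ?_
    symm
    rw [← hU.integral_gradForm hM hP hreg hE hB α hθU]
    -- Equality of functionals is tested on each direction `v`; the inner product with `v` and
    -- evaluation at `v` both pass through the integral.
    ext v
    rw [InnerProductSpace.toDual_apply_apply, real_inner_comm, ← integral_inner hint,
      ContinuousLinearMap.integral_apply hi]
    refine integral_congr_ae ?_
    filter_upwards [heq] with x hx
    rw [hx, real_inner_comm, InnerProductSpace.toDual_symm_apply]
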